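/- Let $M$ be a smooth $n$-dimensional manifold, $\alpha=\sqrt{a_{ij}(x)y^iy^j}$ a smooth Riemannian metric and $\beta=b_i(x)y^i$ a smooth $1$-form on $M$, and put $b=\|\beta_x\|_\alpha$. Let $b_o\in(0,\infty]$ with $\|\beta_x\|_\alpha<b_o$ for all $x\in M$, let $\phi=\phi(b^2,s)$ be a positive smooth function on the domain $|s|\le b<b_o$, and suppose that $F=\alpha\,\phi(b^2,s)$, $s=\beta/\alpha$, is a Finsler metric on $M$ (that is, $F$ is a general $(\alpha,\beta)$-metric). Suppose that there is a scalar function $c=c(x)$ on $M$ with $$b_{i|j}=c\,a_{ij},$$ where $b_{i|j}$ is the covariant derivative of $\beta$ with respect to $\alpha$. Let $G^i=\frac14 g^{il}\{[F^2]_{x^ky^l}y^k-[F^2]_{x^l}\}$, with $(g^{ij})=(\frac12[F^2]_{y^iy^j})^{-1}$, be the geodesic coefficients of $F$ and $$D^i{}_{jkl}=\frac{\partial^3}{\partial y^j\partial y^k\partial y^l}\Big(G^i-\frac1{n+1}\frac{\partial G^m}{\partial y^m}y^i\Big)$$ its Douglas tensor. Write $y_i=a_{ij}y^j$, $b^i=a^{ij}b_j$,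 let subscripts $1,2$ on functions of $(b^2,s)$ denote partial derivatives in $b^2$ and in $s$, and put $$H=\frac{\phi_{22}-2(\phi_1-s\phi_{12})}{2[\phi-s\phi_2+(b^2-s^2)\phi_{22}]},\qquad T=-\frac1{n+1}\big[2sH+(b^2-s^2)H_2\big].$$ Then in all local coordinates and for all $y\neq0$ $$\begin{aligned} D^i{}_{jkl}={}&\frac{c}{\alpha}\Big\{\big[(T-sT_2)a_{kl}+T_{22}b_lb_k\big]\delta^i{}_j+\frac1{\alpha^2}\Big[\frac s\alpha(3T_{22}+sT_{222})y_ly_j-(T_{22}+sT_{222})b_ly_j\Big]b_ky^i\Big\}(k\to l\to j\to k)\\ &-\frac{c}{\alpha^2}\Big\{sT_{22}\big[(y_kb_l+y_lb_k)\delta^i{}_j+a_{jl}b_ky^i\big]+\frac1\alpha(T-sT_2-s^2T_{22})(y_l\delta^i{}_j+a_{lj}y^i)y_k\Big\}(k\to l\to j\to k)\\ &+\frac{c}{\alpha^2}\Big[\frac1{\alpha^3}(3T-3sT_2-6s^2T_{22}-s^3T_{222})y_ky_jy_l+T_{222}b_lb_kb_j\Big]y^i\\ &+\frac c\alpha\Big[(H_2-sH_{22})\Big(b_j-\frac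 s\alpha y_j\Big)a_{kl}-\frac1{\alpha^2}(H_2-sH_{22}-s^2H_{222})b_ly_jy_k-\frac{sH_{222}}{\alpha}b_kb_ly_j\Big]b^i(k\to l\to j\to k)\\ &+\frac c\alpha\Big[\frac s{\alpha^3}(3H_2-3sH_{22}-s^2H_{222})y_jy_ky_l+H_{222}b_lb_kb_j\Big]b^i, \end{aligned}$$ where $\{\cdots\}(k\to l\to j\to k)$ denotes the sum of the expression over the three cyclic permutations of $(j,k,l)$. In particular, if $c$ vanishes identically, then $D^i{}_{jkl}=0$, i.e. $F$ is a Douglas metric. -/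

import Mathlib

open Bundle
open scoped Manifold ContDiff ENNReal

noncomputable section

namespace GeneralAB

/-- Real `n`-space, the model of an `n`-dimensional manifold. -/
abbrev E (n : ℕ) := EuclideanSpace ℝ (Fin n)

/-- The partial derivative of `f` at `x` in the `i`-th coordinate direction. -/
def pd {n : ℕ} (i : Fin n) (f : E n → ℝ) (x : E n) : ℝ :=
  fderiv ℝ f x (EuclideanSpace.single i 1)

/-! ### Local coordinates -/

section Coordinates

variable {n : ℕ} {M : Type*} [TopologicalSpace M] [ChartedSpace (E n) M]

/-- The tangent vector `∑ i, y i • ∂/∂xⁱ` at the point with coordinates `x` in the chart `e`. -/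
def coordVec (e : OpenPartialHomeomorph M (E n)) (x y : E n) :
    TangentSpace (𝓡 n) (e.symm x) :=
  mfderiv 𝓘(ℝ, E n) (𝓡 n) e.symm x y

/-- A function on the tangent bundle in the coordinates `(x, y)` induced by the chart `e`. -/
def inCoord (e : OpenPartialHomeomorph M (E n)) (F : (p : M) → TangentSpace (𝓡 n) p → ℝ)
    (x y : E n) : ℝ :=
  F (e.symm x) (coordVec e x y)

/-- The components `b_i` of a `1`-form in the chart `e`. -/
def formCoef (e : OpenPartialHomeomorph M (E n)) (β : (p : M) → TangentSpace (𝓡 n) p →L[ℝ] ℝ)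
    (x : E n) (i : Fin n) : ℝ :=
  β (e.symm x) (coordVec e x (EuclideanSpace.single i 1))

variable [RiemannianBundle (fun p : M ↦ TangentSpace (𝓡 n) p)]

/-- The components `a_ij` of the Riemannian metric in the chart `e`. -/
def metricCoef (e : OpenPartialHomeomorph M (E n)) (x : E n) : Matrix (Fin n) (Fin n) ℝ :=
  Matrix.of fun i j ↦ inner ℝ (coordVec e x (EuclideanSpace.single i 1))
    (coordVec e x (EuclideanSpace.single j 1))

/-- The Christoffel symbols `Γ^k_ij` of the Riemannian metric in the chart `e`. -/
def christoffel (e : OpenPartialHomeomorph M (E n)) (x : E n) (k i j : Fin n) : ℝ :=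
  1 / 2 * ∑ l, (metricCoef e x)⁻¹ k l *
    (pd i (fun x' ↦ metricCoef e x' l j) x + pd j (fun x' ↦ metricCoef e x' l i) x
      - pd l (fun x' ↦ metricCoef e x' i j) x)

/-- The components `b_{i|j}` of the covariant derivative of a `1`-form with respect to the
Levi-Civita connection. -/
def covDeriv (e : OpenPartialHomeomorph M (E n)) (β : (p : M) → TangentSpace (𝓡 n) p →L[ℝ] ℝ)
    (x : E n) (i j : Fin n) : ℝ :=
  pd j (fun x' ↦ formCoef e β x' i) x - ∑ k, christoffel e x k i j * formCoef e β x k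

/-- The equation `b_{i|j} = c a_ij`, in all local coordinates. -/
def CovDerivEq (β : (p : M) → TangentSpace (𝓡 n) p →L[ℝ] ℝ) (c : M → ℝ) : Prop :=
  ∀ e ∈ IsManifold.maximalAtlas (𝓡 n) ∞ M, ∀ x ∈ e.target, ∀ i j,
    covDeriv e β x i j = c (e.symm x) * metricCoef e x i j

end Coordinates

/-! ### Finsler metrics, geodesic coefficients and the Douglas tensor -/

section Finsler

variable {n : ℕ}

/-- The fundamental tensor `g_ij = ½ [F²]_{yⁱyʲ}` of a function `L x y` of coordinates and
velocities. -/
def fundTensor (L : E n → E n → ℝ) (x y : E n) : Matrix (Fin n) (Fin n) ℝ :=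
  Matrix.of fun i j ↦ 1 / 2 * pd j (fun y' ↦ pd i (fun y'' ↦ L x y'' ^ 2) y') y

/-- The geodesic coefficients `Gⁱ = ¼ gⁱˡ ([F²]_{xᵏyˡ} yᵏ - [F²]_{xˡ})`. -/
def spray (L : E n → E n → ℝ) (i : Fin n) (x y : E n) : ℝ :=
  1 / 4 * ∑ l, (fundTensor L x y)⁻¹ i l *
    (∑ k, pd l (fun y' ↦ pd k (fun x' ↦ L x' y' ^ 2) x) y * y k
      - pd l (fun x' ↦ L x' y ^ 2) x)

/-- The components `Dⁱ_jkl = ∂³/∂yʲ∂yᵏ∂yˡ (Gⁱ - 1/(n+1) (∂Gᵐ/∂yᵐ) yⁱ)` of the Douglas tensor. -/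
def douglas (L : E n → E n → ℝ) (i j k l : Fin n) (x y : E n) : ℝ :=
  pd l (fun y₂ ↦ pd k (fun y₁ ↦ pd j (fun y₀ ↦
    spray L i x y₀ - 1 / ((n : ℝ) + 1) * (∑ m, pd m (fun y' ↦ spray L m x y') y₀) * y₀ i)
      y₁) y₂) y

variable {M : Type*} [TopologicalSpace M] [ChartedSpace (E n) M]

/-- Finsler metrics: positive, smooth off the zero section, positively homogeneous, with positive
definite fundamental tensor. -/
structure IsFinslerMetric (F : (p : M) → TangentSpace (𝓡 n) p → ℝ) : Prop where
  pos : ∀ p v, v ≠ 0 → 0 < F p v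
  homogeneous : ∀ p v (r : ℝ), 0 < r → F p (r • v) = r * F p v
  smooth : ∀ e ∈ IsManifold.maximalAtlas (𝓡 n) ∞ M,
    ContDiffOn ℝ ∞ (fun z : E n × E n ↦ inCoord e F z.1 z.2) (e.target ×ˢ {0}ᶜ)
  posDef : ∀ e ∈ IsManifold.maximalAtlas (𝓡 n) ∞ M, ∀ x ∈ e.target, ∀ y ≠ 0,
    (fundTensor (inCoord e F) x y).PosDef

/-- Douglas metrics: the Douglas tensor vanishes (at all nonzero tangent vectors). -/
def IsDouglasMetric (F : (p : M) → TangentSpace (𝓡 n) p → ℝ) : Prop :=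
  ∀ e ∈ IsManifold.maximalAtlas (𝓡 n) ∞ M, ∀ x ∈ e.target, ∀ y ≠ 0, ∀ i j k l,
    douglas (inCoord e F) i j k l x y = 0

end Finsler

/-! ### General `(α, β)`-metrics -/

/-- The domain `|s| ≤ b < b₀` of `φ`, in the variables `(b², s)`. -/
def dom (b₀ : ℝ≥0∞) : Set (ℝ × ℝ) :=
  {q | q.2 ^ 2 ≤ q.1 ∧ ENNReal.ofReal (√q.1) < b₀}

/-- The partial derivative in the first variable `b²` of a function on the domain `|s| ≤ b < b₀`.
(The domain is convex with interior points, so derivatives within it are unique.) -/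
def d1 (b₀ : ℝ≥0∞) (f : ℝ × ℝ → ℝ) (q : ℝ × ℝ) : ℝ := fderivWithin ℝ f (dom b₀) q (1, 0)

/-- The partial derivative in the second variable `s`. -/
def d2 (b₀ : ℝ≥0∞) (f : ℝ × ℝ → ℝ) (q : ℝ × ℝ) : ℝ := fderivWithin ℝ f (dom b₀) q (0, 1)

/-- `H = (φ₂₂ - 2 (φ₁ - s φ₁₂)) / (2 [φ - s φ₂ + (b² - s²) φ₂₂])` as a function of `(b², s)`. -/
def funH (b₀ : ℝ≥0∞) (φ : ℝ × ℝ → ℝ) (q : ℝ × ℝ) : ℝ :=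
  (d2 b₀ (d2 b₀ φ) q - 2 * (d1 b₀ φ q - q.2 * d2 b₀ (d1 b₀ φ) q)) /
    (2 * (φ q - q.2 * d2 b₀ φ q + (q.1 - q.2 ^ 2) * d2 b₀ (d2 b₀ φ) q))

/-- `T = -1/(n+1) [2 s H + (b² - s²) H₂]` as a function of `(b², s)`. -/
def funT (n : ℕ) (b₀ : ℝ≥0∞) (φ : ℝ × ℝ → ℝ) (q : ℝ × ℝ) : ℝ :=
  -(1 / ((n : ℝ) + 1)) *
    (2 * q.2 * funH b₀ φ q + (q.1 - q.2 ^ 2) * d2 b₀ (funH b₀ φ) q)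

/-- The function `F = α φ(b², β/α)` on the tangent bundle, with `α` the norm of the Riemannian
metric and `b` the (dual) norm of the `1`-form `β`. -/
def metric {n : ℕ} {M : Type*} [TopologicalSpace M] [ChartedSpace (E n) M]
    [RiemannianBundle (fun p : M ↦ TangentSpace (𝓡 n) p)]
    (φ : ℝ × ℝ → ℝ) (β : (p : M) → TangentSpace (𝓡 n) p →L[ℝ] ℝ)
    (p : M) (v : TangentSpace (𝓡 n) p) : ℝ :=
  ‖v‖ * φ (‖β p‖ ^ 2, β p v / ‖v‖)

/-- The cyclic sum `f(j,k,l) (k → l → j → k)`. -/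
def cyc {n : ℕ} (f : Fin n → Fin n → Fin n → ℝ) (j k l : Fin n) : ℝ :=
  f j k l + f k l j + f l j k

end GeneralAB

end

noncomputable section

namespace GeneralAB

/-! Work at one point in one chart. The equation $b_{i|j}=c\,a_{ij}$ makes the horizontal
derivatives explicit: that of $\alpha$ is zero, that of $\beta$ is $c\,y_k$, that of $b^2$ is
$2c\,b_k$ (`ConformalAt.hasPD_al`, `ConformalAt.hasPD_bet`, `ConformalAt.hasPD_norm`). Hence $F^2$
changes in $x$ only through the connection and through terms proportional to $c$.

The inverse of $g_{ij}$ is never computed. By `Frame.sum_gTensor_self` and `Frame.sum_gTensor_bu`,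
lowering $y^i$ and $b^i$ with $g$ gives combinations of $F_{y^l}$ and the form $b_l-sy_l/\alpha$,
and the $c$-part of the bracket defining $G^i$ is a combination of the same two. Matching
coefficients yields `ConformalAt.spray_eq`: $G^i=\frac12\Gamma^i_{jk}y^jy^k+c\,(\alpha
E\,y^i+\alpha^2H\,b^i)$. By homogeneity the trace $\partial G^m/\partial y^m$ is a linear form plus
$c(n+1)\alpha(E-T)$ (`ConformalAt.sum_pd_spray`). So $E$ drops out, and the function whose third
derivatives form the Douglas tensor is a quadratic polynomial in $y$ plus $c\,(\alpha
T\,y^i+\alpha^2H\,b^i)$. Three differentiations kill the polynomial, and the rest is the stated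
formula (`pd_pd_pd_eq`, `Frame.hasPD_al_mul₃`, `Frame.hasPD_al_sq_mul₃`).

Dividing by $\Delta=\phi-s\phi_2+(b^2-s^2)\phi_{22}$ requires $\Delta\ne0$. For $n\ge2$ this follows
from positive definiteness of $g$ (`Frame.funDelta_ne_zero`). For $n=1$ positivity of $g$ says
nothing about $\Delta$, but both sides of the formula vanish, whatever values $H$ and $T$ take
(`douglas_eq_zero_of_dim_one`, `douglasFormula_eq_zero`). -/

variable {n : ℕ}

/-! ### Calculus of coordinate partial derivatives -/

/-- `f` is differentiable at `x` and its partial derivatives there are `g`. -/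
structure HasPD (f : E n → ℝ) (g : Fin n → ℝ) (x : E n) : Prop where
  diff : DifferentiableAt ℝ f x
  pd_eq : ∀ i, pd i f x = g i

namespace HasPD

variable {f f' : E n → ℝ} {g g' : Fin n → ℝ} {x : E n}

theorem of_diff (h : DifferentiableAt ℝ f x) : HasPD f (fun i ↦ pd i f x) x := ⟨h, fun _ ↦ rfl⟩

theorem congr_grad (h : HasPD f g x) (e : ∀ i, g i = g' i) : HasPD f g' x :=
  ⟨h.diff, fun i ↦ (h.pd_eq i).trans (e i)⟩

theorem congr_fun (h : HasPD f g x) (e : f' =ᶠ[nhds x] f) : HasPD f' g x :=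
  ⟨h.diff.congr_of_eventuallyEq e, fun i ↦ by
    rw [pd, e.fderiv_eq]; exact h.pd_eq i⟩

theorem const (r : ℝ) : HasPD (fun _ : E n ↦ r) (fun _ ↦ 0) x :=
  ⟨differentiableAt_const r, fun i ↦ by simp [pd]⟩

theorem coord (j : Fin n) : HasPD (fun y : E n ↦ y j) (fun i ↦ if j = i then 1 else 0) x := by
  have h : HasFDerivAt (fun y : E n ↦ y j) (EuclideanSpace.proj j : E n →L[ℝ] ℝ) x :=
    (EuclideanSpace.proj j : E n →L[ℝ] ℝ).hasFDerivAt
  exact ⟨h.differentiableAt, fun i ↦ by simp [pd, h.fderiv]⟩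

theorem add (h : HasPD f g x) (h' : HasPD f' g' x) :
    HasPD (fun y ↦ f y + f' y) (fun i ↦ g i + g' i) x :=
  ⟨h.diff.fun_add h'.diff, fun i ↦ by
    rw [← h.pd_eq, ← h'.pd_eq, pd, fderiv_fun_add h.diff h'.diff]; rfl⟩

theorem sub (h : HasPD f g x) (h' : HasPD f' g' x) :
    HasPD (fun y ↦ f y - f' y) (fun i ↦ g i - g' i) x :=
  ⟨h.diff.fun_sub h'.diff, fun i ↦ by
    rw [← h.pd_eq, ← h'.pd_eq, pd, fderiv_fun_sub h.diff h'.diff]; rfl⟩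

theorem mul (h : HasPD f g x) (h' : HasPD f' g' x) :
    HasPD (fun y ↦ f y * f' y) (fun i ↦ g i * f' x + f x * g' i) x :=
  ⟨h.diff.fun_mul h'.diff, fun i ↦ by
    rw [← h.pd_eq, ← h'.pd_eq, pd, fderiv_fun_mul h.diff h'.diff]
    simp [pd]; ring⟩

theorem const_mul (r : ℝ) (h : HasPD f g x) : HasPD (fun y ↦ r * f y) (fun i ↦ r * g i) x :=
  ((const r).mul h).congr_grad fun i ↦ by ring

theorem mul_const (r : ℝ) (h : HasPD f g x) : HasPD (fun y ↦ f y * r) (fun i ↦ g i * r) x :=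
  (h.mul (const r)).congr_grad fun i ↦ by ring

theorem sum {ι : Type*} {s : Finset ι} {f : ι → E n → ℝ} {g : ι → Fin n → ℝ}
    (h : ∀ j ∈ s, HasPD (f j) (g j) x) :
    HasPD (fun y ↦ ∑ j ∈ s, f j y) (fun i ↦ ∑ j ∈ s, g j i) x :=
  ⟨DifferentiableAt.fun_sum fun j hj ↦ (h j hj).diff, fun i ↦ by
    rw [pd, fderiv_fun_sum fun j hj ↦ (h j hj).diff]
    simp only [FunLike.coe_sum, Finset.sum_apply]
    exact Finset.sum_congr rfl fun j hj ↦ (h j hj).pd_eq i⟩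

theorem comp_deriv {u : ℝ → ℝ} {u' : ℝ} (hu : HasDerivAt u u' (f x)) (h : HasPD f g x) :
    HasPD (fun y ↦ u (f y)) (fun i ↦ u' * g i) x := by
  have : HasFDerivAt (fun y ↦ u (f y)) (u' • fderiv ℝ f x) x :=
    hu.comp_hasFDerivAt x h.diff.hasFDerivAt
  exact ⟨this.differentiableAt, fun i ↦ by rw [← h.pd_eq, pd, this.fderiv]; rfl⟩

theorem div (h : HasPD f g x) (h' : HasPD f' g' x) (h0 : f' x ≠ 0) :
    HasPD (fun y ↦ f y / f' y) (fun i ↦ (g i - f x / f' x * g' i) / f' x) x := by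
  simp only [div_eq_mul_inv]
  refine (h.mul (comp_deriv (hasDerivAt_inv h0) h')).congr_grad fun i ↦ ?_
  field_simp
  ring

/-- The chain rule for functions on the domain of `φ`. -/
theorem comp_dom {b₀ : ℝ≥0∞} {u : ℝ × ℝ → ℝ} (h : HasPD f g x) (h' : HasPD f' g' x)
    (hu : DifferentiableWithinAt ℝ u (dom b₀) (f x, f' x))
    (hd : ∀ᶠ y in nhds x, (f y, f' y) ∈ dom b₀) :
    HasPD (fun y ↦ u (f y, f' y))
      (fun i ↦ d1 b₀ u (f x, f' x) * g i + d2 b₀ u (f x, f' x) * g' i) x := by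
  have h2 : HasFDerivAt (fun y ↦ (f y, f' y)) ((fderiv ℝ f x).prod (fderiv ℝ f' x)) x :=
    h.diff.hasFDerivAt.prodMk h'.diff.hasFDerivAt
  have h3 : HasFDerivAt (fun y ↦ u (f y, f' y))
      ((fderivWithin ℝ u (dom b₀) (f x, f' x)).comp
        ((fderiv ℝ f x).prod (fderiv ℝ f' x))) x := by
    -- The outer function is differentiable only within the domain, which has boundary. The inner
    -- pair stays in the domain on a neighbourhood of `x`, so the composite is differentiable
    -- without restriction.
    have h4 := hu.hasFDerivWithinAt.comp (t := dom b₀) (s := {y | (f y, f' y) ∈ dom b₀}) x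
      h2.hasFDerivWithinAt (fun y hy ↦ hy)
    exact h4.hasFDerivAt hd
  refine ⟨h3.differentiableAt, fun i ↦ ?_⟩
  rw [← h.pd_eq, ← h'.pd_eq, pd, h3.fderiv]
  have e : ((fderiv ℝ f x).prod (fderiv ℝ f' x)) (EuclideanSpace.single i 1)
      = pd i f x • ((1 : ℝ), (0 : ℝ)) + pd i f' x • ((0 : ℝ), (1 : ℝ)) := by
    simp [pd]
  rw [ContinuousLinearMap.comp_apply, e, map_add, map_smul, map_smul]
  simp [d1, d2]
  ring

end HasPD

theorem pd_congr {f f' : E n → ℝ} {x : E n} (i : Fin n) (e : f =ᶠ[nhds x] f') :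
    pd i f x = pd i f' x := by
  rw [pd, pd, e.fderiv_eq]

/-! ### The domain of `φ` -/

/-- An epigraph of $s\mapsto s^2$ cut by a condition that is downward closed in $b^2$. -/
theorem convex_dom (b₀ : ℝ≥0∞) : Convex ℝ (dom b₀) := by
  have h1 : Convex ℝ {q : ℝ × ℝ | q.2 ^ 2 ≤ q.1} := by
    rintro ⟨t, s⟩ h ⟨t', s'⟩ h' a b ha hb hab
    simp only [Set.mem_ofPred_eq, Prod.smul_mk, Prod.mk_add_mk, smul_eq_mul] at h h' ⊢
    have : b = 1 - a := by linarith
    subst this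
    nlinarith [mul_nonneg (mul_nonneg ha hb) (sq_nonneg (s - s')),
      mul_le_mul_of_nonneg_left h ha, mul_le_mul_of_nonneg_left h' hb]
  have h2 : Convex ℝ {t : ℝ | ENNReal.ofReal √t < b₀} := by
    have : IsLowerSet {t : ℝ | ENNReal.ofReal √t < b₀} := fun t t' htt ht ↦
      lt_of_le_of_lt (ENNReal.ofReal_le_ofReal (Real.sqrt_le_sqrt htt)) ht
    exact this.ordConnected.convex
  exact h1.inter (h2.linear_preimage (LinearMap.fst ℝ ℝ ℝ))

/-- The boundary $|s|=b$ is reached whenever $y$ is parallel to $b^i$, so derivatives within the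
domain must be well defined, and smooth again, up to the boundary. -/
theorem uniqueDiffOn_dom {b₀ : ℝ≥0∞} (hb₀ : 0 < b₀) : UniqueDiffOn ℝ (dom b₀) := by
  refine uniqueDiffOn_convex (convex_dom b₀) ?_
  obtain ⟨r, hr0, hr⟩ : ∃ r : ℝ, 0 < r ∧ ENNReal.ofReal r < b₀ := by
    obtain ⟨r, h0, h⟩ := ENNReal.lt_iff_exists_nnreal_btwn.1 hb₀
    exact ⟨r, by exact_mod_cast h0, by simpa using h⟩
  have ho : IsOpen {q : ℝ × ℝ | q.2 ^ 2 < q.1 ∧ q.1 < r ^ 2} :=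
    IsOpen.and (isOpen_lt (by fun_prop) (by fun_prop)) (isOpen_lt (by fun_prop) (by fun_prop))
  refine ⟨(r ^ 2 / 2, 0), interior_maximal ?_ ho ?_⟩
  · rintro q ⟨h, h'⟩
    refine ⟨h.le, lt_of_le_of_lt (ENNReal.ofReal_le_ofReal ?_) hr⟩
    exact Real.sqrt_le_iff.2 ⟨hr0.le, h'.le⟩
  · constructor <;> simp only <;> nlinarith

/-! ### Smoothness of $H$, $T$ and $E$ where the denominators do not vanish -/

section Smooth

variable {b₀ : ℝ≥0∞} {f : ℝ × ℝ → ℝ} {q : ℝ × ℝ}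

theorem contDiffWithinAt_d1 (hb₀ : 0 < b₀) (hq : q ∈ dom b₀)
    (h : ContDiffWithinAt ℝ ∞ f (dom b₀) q) : ContDiffWithinAt ℝ ∞ (d1 b₀ f) (dom b₀) q :=
  (h.fderivWithin_right (uniqueDiffOn_dom hb₀) (by simp) hq).clm_apply contDiffWithinAt_const

theorem contDiffWithinAt_d2 (hb₀ : 0 < b₀) (hq : q ∈ dom b₀)
    (h : ContDiffWithinAt ℝ ∞ f (dom b₀) q) : ContDiffWithinAt ℝ ∞ (d2 b₀ f) (dom b₀) q :=
  (h.fderivWithin_right (uniqueDiffOn_dom hb₀) (by simp) hq).clm_apply contDiffWithinAt_const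

/-- The denominator `φ - s φ₂ + (b² - s²) φ₂₂`. -/
def funDelta (b₀ : ℝ≥0∞) (φ : ℝ × ℝ → ℝ) (q : ℝ × ℝ) : ℝ :=
  φ q - q.2 * d2 b₀ φ q + (q.1 - q.2 ^ 2) * d2 b₀ (d2 b₀ φ) q

theorem contDiffWithinAt_funH (hb₀ : 0 < b₀) (hq : q ∈ dom b₀)
    (h : ContDiffWithinAt ℝ ∞ f (dom b₀) q) (hΔ : funDelta b₀ f q ≠ 0) :
    ContDiffWithinAt ℝ ∞ (funH b₀ f) (dom b₀) q := by
  have h1 := contDiffWithinAt_d1 hb₀ hq h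
  have h2 := contDiffWithinAt_d2 hb₀ hq h
  have h22 := contDiffWithinAt_d2 hb₀ hq h2
  have h12 := contDiffWithinAt_d2 hb₀ hq h1
  have hf : ContDiffWithinAt ℝ ∞ (fun q : ℝ × ℝ ↦ q.1) (dom b₀) q := contDiffWithinAt_fst
  have hs : ContDiffWithinAt ℝ ∞ (fun q : ℝ × ℝ ↦ q.2) (dom b₀) q := contDiffWithinAt_snd
  refine ContDiffWithinAt.div (h22.sub (contDiffWithinAt_const.mul (h1.sub (hs.mul h12))))
    (contDiffWithinAt_const.mul ((h.sub (hs.mul h2)).add ((hf.sub (hs.pow 2)).mul h22))) ?_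
  exact mul_ne_zero two_ne_zero hΔ

theorem contDiffWithinAt_funT (hb₀ : 0 < b₀) (hq : q ∈ dom b₀)
    (h : ContDiffWithinAt ℝ ∞ f (dom b₀) q) (hΔ : funDelta b₀ f q ≠ 0) :
    ContDiffWithinAt ℝ ∞ (funT n b₀ f) (dom b₀) q := by
  have hH := contDiffWithinAt_funH hb₀ hq h hΔ
  have hf : ContDiffWithinAt ℝ ∞ (fun q : ℝ × ℝ ↦ q.1) (dom b₀) q := contDiffWithinAt_fst
  have hs : ContDiffWithinAt ℝ ∞ (fun q : ℝ × ℝ ↦ q.2) (dom b₀) q := contDiffWithinAt_snd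
  exact contDiffWithinAt_const.mul (((contDiffWithinAt_const.mul hs).mul hH).add
    ((hf.sub (hs.pow 2)).mul (contDiffWithinAt_d2 hb₀ hq hH)))

/-- The coefficient of `c α yⁱ` in the geodesic coefficients. -/
def funE (b₀ : ℝ≥0∞) (φ : ℝ × ℝ → ℝ) (q : ℝ × ℝ) : ℝ :=
  ((d2 b₀ φ q + 2 * q.2 * d1 b₀ φ q) / 2
    - funH b₀ φ q * (q.2 * φ q + (q.1 - q.2 ^ 2) * d2 b₀ φ q)) / φ q

theorem contDiffWithinAt_funE (hb₀ : 0 < b₀) (hq : q ∈ dom b₀)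
    (h : ContDiffWithinAt ℝ ∞ f (dom b₀) q) (hΔ : funDelta b₀ f q ≠ 0) (h0 : f q ≠ 0) :
    ContDiffWithinAt ℝ ∞ (funE b₀ f) (dom b₀) q := by
  have h1 := contDiffWithinAt_d1 hb₀ hq h
  have h2 := contDiffWithinAt_d2 hb₀ hq h
  have hH := contDiffWithinAt_funH hb₀ hq h hΔ
  have hf : ContDiffWithinAt ℝ ∞ (fun q : ℝ × ℝ ↦ q.1) (dom b₀) q := contDiffWithinAt_fst
  have hs : ContDiffWithinAt ℝ ∞ (fun q : ℝ × ℝ ↦ q.2) (dom b₀) q := contDiffWithinAt_snd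
  exact (((h2.add ((contDiffWithinAt_const.mul hs).mul h1)).div_const 2).sub
    (hH.mul ((hs.mul h).add ((hf.sub (hs.pow 2)).mul h2)))).div h h0

end Smooth

/-! ### One tangent space: $\alpha$, $\beta$, $s$ and their derivatives in $y$ -/

/-- The components `y_i = a_ij yʲ`. -/
def low (A : Matrix (Fin n) (Fin n) ℝ) (y : E n) (i : Fin n) : ℝ := ∑ j, A i j * y j

/-- The norm `α = √(a_ij yⁱ yʲ)`. -/
def al (A : Matrix (Fin n) (Fin n) ℝ) (y : E n) : ℝ := √(∑ i, low A y i * y i)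

/-- The linear form `β = b_i yⁱ`. -/
def bet (B : Fin n → ℝ) (y : E n) : ℝ := ∑ i, B i * y i

/-- The quotient `s = β / α`. -/
def sv (A : Matrix (Fin n) (Fin n) ℝ) (B : Fin n → ℝ) (y : E n) : ℝ := bet B y / al A y

/-- The algebraic relations among the components `a_ij`, `b_i`, `bⁱ` and `b²` at a point. -/
structure Frame (b₀ : ℝ≥0∞) (A : Matrix (Fin n) (Fin n) ℝ) (B bu : Fin n → ℝ) (t : ℝ) :
    Prop where
  symm : ∀ i j, A i j = A j i
  pos : ∀ y : E n, y ≠ 0 → 0 < ∑ i, low A y i * y i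
  raise : ∀ i, ∑ j, A i j * bu j = B i
  norm : ∑ i, B i * bu i = t
  mem : ∀ y : E n, y ≠ 0 → (t, sv A B y) ∈ dom b₀

theorem hasPD_low (A : Matrix (Fin n) (Fin n) ℝ) (i : Fin n) (y : E n) :
    HasPD (fun y ↦ low A y i) (fun l ↦ A i l) y :=
  (HasPD.sum fun j _ ↦ (HasPD.coord j).const_mul (A i j)).congr_grad fun l ↦ by simp

theorem hasPD_bet (B : Fin n → ℝ) (y : E n) : HasPD (bet B) B y :=
  (HasPD.sum fun j _ ↦ (HasPD.coord j).const_mul (B j)).congr_grad fun l ↦ by simp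

namespace Frame

variable {b₀ : ℝ≥0∞} {A : Matrix (Fin n) (Fin n) ℝ} {B bu : Fin n → ℝ} {t : ℝ}
  (h : Frame b₀ A B bu t) {y : E n}

include h

theorem al_pos (hy : y ≠ 0) : 0 < al A y := Real.sqrt_pos.2 (h.pos y hy)

theorem al_ne (hy : y ≠ 0) : al A y ≠ 0 := (h.al_pos hy).ne'

theorem sum_low_mul (hy : y ≠ 0) : ∑ i, low A y i * y i = al A y ^ 2 :=
  (Real.sq_sqrt (h.pos y hy).le).symm

theorem bet_eq (hy : y ≠ 0) : bet B y = sv A B y * al A y :=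
  (div_mul_cancel₀ _ (h.al_ne hy)).symm

theorem sum_low_mul_bu : ∑ i, low A y i * bu i = bet B y := by
  simp only [low, bet, Finset.sum_mul]
  rw [Finset.sum_comm]
  refine Finset.sum_congr rfl fun j _ ↦ ?_
  rw [← h.raise, Finset.sum_mul]
  exact Finset.sum_congr rfl fun i _ ↦ by rw [h.symm i j]; ring

theorem hasPD_al (hy : y ≠ 0) : HasPD (al A) (fun l ↦ low A y l / al A y) y := by
  refine (HasPD.comp_deriv (Real.hasDerivAt_sqrt (h.pos y hy).ne')
    (HasPD.sum fun j _ ↦ (hasPD_low A j y).mul (HasPD.coord j))).congr_grad fun l ↦ ?_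
  have e : ∑ j, (A j l * y j + low A y j * if j = l then 1 else 0) = 2 * low A y l := by
    simp only [Finset.sum_add_distrib, mul_ite, mul_one, mul_zero, Finset.sum_ite_eq',
      Finset.mem_univ, if_true, two_mul]
    congr 1
    exact Finset.sum_congr rfl fun j _ ↦ by rw [h.symm]
  have h0 := h.al_ne hy
  rw [e, ← al]
  field_simp

theorem hasPD_sv (hy : y ≠ 0) :
    HasPD (sv A B) (fun l ↦ (B l - sv A B y * (low A y l / al A y)) / al A y) y :=
  (hasPD_bet B y).div (h.hasPD_al hy) (h.al_ne hy)

theorem eventually_mem (hy : y ≠ 0) : ∀ᶠ y' in nhds y, (t, sv A B y') ∈ dom b₀ := by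
  filter_upwards [isOpen_ne.mem_nhds hy] with y' hy' using h.mem y' hy'

theorem hasPD_comp {f : ℝ × ℝ → ℝ} (hy : y ≠ 0)
    (hf : ContDiffWithinAt ℝ ∞ f (dom b₀) (t, sv A B y)) :
    HasPD (fun y ↦ f (t, sv A B y)) (fun l ↦ d2 b₀ f (t, sv A B y) *
      ((B l - sv A B y * (low A y l / al A y)) / al A y)) y :=
  ((HasPD.const t).comp_dom (h.hasPD_sv hy) (hf.differentiableWithinAt (by simp))
    (h.eventually_mem hy)).congr_grad fun l ↦ by ring

/-- The first derivatives of `α f(b², s)`. -/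
theorem hasPD_al_mul {f : ℝ × ℝ → ℝ} (hy : y ≠ 0)
    (hf : ContDiffWithinAt ℝ ∞ f (dom b₀) (t, sv A B y)) :
    HasPD (fun y ↦ al A y * f (t, sv A B y))
      (fun l ↦ (f (t, sv A B y) - sv A B y * d2 b₀ f (t, sv A B y)) * low A y l / al A y
        + d2 b₀ f (t, sv A B y) * B l) y := by
  refine ((h.hasPD_al hy).mul (h.hasPD_comp hy hf)).congr_grad fun l ↦ ?_
  have h0 := h.al_ne hy
  field_simp
  ring

/-- The second derivatives of `α f(b², s)`. -/
theorem hasPD_al_mul₂ (hb₀ : 0 < b₀) {f : ℝ × ℝ → ℝ} (hy : y ≠ 0)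
    (hf : ContDiffWithinAt ℝ ∞ f (dom b₀) (t, sv A B y)) (j : Fin n) :
    HasPD (fun y ↦ (f (t, sv A B y) - sv A B y * d2 b₀ f (t, sv A B y)) * low A y j / al A y
        + d2 b₀ f (t, sv A B y) * B j)
      (fun k ↦ (f (t, sv A B y) - sv A B y * d2 b₀ f (t, sv A B y)) *
          (A j k - low A y j * low A y k / al A y ^ 2) / al A y
        + d2 b₀ (d2 b₀ f) (t, sv A B y) * (B j - sv A B y * low A y j / al A y) *
          (B k - sv A B y * low A y k / al A y) / al A y) y := by
  have hf2 := contDiffWithinAt_d2 hb₀ (h.mem y hy) hf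
  refine (((((h.hasPD_comp hy hf).sub ((h.hasPD_sv hy).mul (h.hasPD_comp hy hf2))).mul
    (hasPD_low A j y)).div (h.hasPD_al hy) (h.al_ne hy)).add
    ((h.hasPD_comp hy hf2).mul_const (B j))).congr_grad fun l ↦ ?_
  have h0 := h.al_ne hy
  field_simp
  ring

/-- The third derivatives of `α f(b², s)`. -/
theorem hasPD_al_mul₃ (hb₀ : 0 < b₀) {f : ℝ × ℝ → ℝ} (hy : y ≠ 0)
    (hf : ContDiffWithinAt ℝ ∞ f (dom b₀) (t, sv A B y)) (j k : Fin n) :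
    HasPD (fun y ↦ (f (t, sv A B y) - sv A B y * d2 b₀ f (t, sv A B y)) *
          (A j k - low A y j * low A y k / al A y ^ 2) / al A y
        + d2 b₀ (d2 b₀ f) (t, sv A B y) * (B j - sv A B y * low A y j / al A y) *
          (B k - sv A B y * low A y k / al A y) / al A y)
      (fun l ↦ 1 / al A y ^ 2 *
        (d2 b₀ (d2 b₀ (d2 b₀ f)) (t, sv A B y) * (B j - sv A B y * low A y j / al A y) *
          (B k - sv A B y * low A y k / al A y) * (B l - sv A B y * low A y l / al A y)
        - d2 b₀ (d2 b₀ f) (t, sv A B y) *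
          (sv A B y * (A j k - low A y j * low A y k / al A y ^ 2) *
            (B l - sv A B y * low A y l / al A y)
          + (sv A B y * (A j l - low A y j * low A y l / al A y ^ 2)
              + low A y j / al A y * (B l - sv A B y * low A y l / al A y)) *
            (B k - sv A B y * low A y k / al A y)
          + (sv A B y * (A k l - low A y k * low A y l / al A y ^ 2)
              + low A y k / al A y * (B l - sv A B y * low A y l / al A y)) *
            (B j - sv A B y * low A y j / al A y)
          + (B j - sv A B y * low A y j / al A y) *
            (B k - sv A B y * low A y k / al A y) * (low A y l / al A y))
        - (f (t, sv A B y) - sv A B y * d2 b₀ f (t, sv A B y)) / al A y *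
          (A j l * low A y k + A k l * low A y j + A j k * low A y l
            - 3 * low A y j * low A y k * low A y l / al A y ^ 2))) y := by
  have hf2 := contDiffWithinAt_d2 hb₀ (h.mem y hy) hf
  have hf22 := contDiffWithinAt_d2 hb₀ (h.mem y hy) hf2
  have hv (j : Fin n) := (HasPD.const (x := y) (B j)).sub
    (((h.hasPD_sv hy).mul (hasPD_low A j y)).div (h.hasPD_al hy) (h.al_ne hy))
  have hα2 := (h.hasPD_al hy).mul (h.hasPD_al hy)
  simp only [← pow_two] at hα2
  refine (((((h.hasPD_comp hy hf).sub ((h.hasPD_sv hy).mul (h.hasPD_comp hy hf2))).mul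
    ((HasPD.const (A j k)).sub (((hasPD_low A j y).mul (hasPD_low A k y)).div hα2
      (pow_ne_zero 2 (h.al_ne hy))))).div (h.hasPD_al hy) (h.al_ne hy)).add
    ((((h.hasPD_comp hy hf22).mul (hv j)).mul (hv k)).div
      (h.hasPD_al hy) (h.al_ne hy))).congr_grad fun l ↦ ?_
  have h0 := h.al_ne hy
  field_simp
  ring

end Frame

/-! ### The fundamental tensor -/

/-- The first derivatives in `y` of `α φ(b², s)`. -/
def gradF (b₀ : ℝ≥0∞) (φ : ℝ × ℝ → ℝ) (A : Matrix (Fin n) (Fin n) ℝ) (B : Fin n → ℝ) (t : ℝ)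
    (i : Fin n) (y : E n) : ℝ :=
  (φ (t, sv A B y) - sv A B y * d2 b₀ φ (t, sv A B y)) * low A y i / al A y
    + d2 b₀ φ (t, sv A B y) * B i

/-- The components of the form `b_i - s y_i / α`, which annihilates `y`. -/
def orthForm (A : Matrix (Fin n) (Fin n) ℝ) (B : Fin n → ℝ) (i : Fin n) (y : E n) : ℝ :=
  B i - sv A B y * low A y i / al A y

/-- The fundamental tensor of `α φ(b², s)`. -/
def gTensor (b₀ : ℝ≥0∞) (φ : ℝ × ℝ → ℝ) (A : Matrix (Fin n) (Fin n) ℝ) (B : Fin n → ℝ) (t : ℝ)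
    (i j : Fin n) (y : E n) : ℝ :=
  gradF b₀ φ A B t i y * gradF b₀ φ A B t j y
    + φ (t, sv A B y) * ((φ (t, sv A B y) - sv A B y * d2 b₀ φ (t, sv A B y)) *
        (A i j - low A y i * low A y j / al A y ^ 2)
      + d2 b₀ (d2 b₀ φ) (t, sv A B y) * orthForm A B i y * orthForm A B j y)

section Contractions

variable {b₀ : ℝ≥0∞} {A : Matrix (Fin n) (Fin n) ℝ} {B : Fin n → ℝ} {t : ℝ} {y : E n}
  {φ : ℝ × ℝ → ℝ}

theorem sum_gradF (w : Fin n → ℝ) :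
    ∑ j, gradF b₀ φ A B t j y * w j =
      (φ (t, sv A B y) - sv A B y * d2 b₀ φ (t, sv A B y)) / al A y * (∑ j, low A y j * w j)
        + d2 b₀ φ (t, sv A B y) * ∑ j, B j * w j := by
  simp only [gradF, Finset.mul_sum, ← Finset.sum_add_distrib]
  exact Finset.sum_congr rfl fun j _ ↦ by ring

theorem sum_orthForm (w : Fin n → ℝ) :
    ∑ j, orthForm A B j y * w j =
      (∑ j, B j * w j) - sv A B y / al A y * ∑ j, low A y j * w j := by
  simp only [orthForm, Finset.mul_sum, ← Finset.sum_sub_distrib]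
  exact Finset.sum_congr rfl fun j _ ↦ by ring

theorem sum_gTensor (i : Fin n) (w : Fin n → ℝ) :
    ∑ j, gTensor b₀ φ A B t i j y * w j =
      gradF b₀ φ A B t i y * (∑ j, gradF b₀ φ A B t j y * w j)
      + φ (t, sv A B y) * ((φ (t, sv A B y) - sv A B y * d2 b₀ φ (t, sv A B y)) *
        ((∑ j, A i j * w j) - low A y i / al A y ^ 2 * ∑ j, low A y j * w j)
      + d2 b₀ (d2 b₀ φ) (t, sv A B y) * orthForm A B i y * ∑ j, orthForm A B j y * w j) := by
  simp only [gTensor, Finset.mul_sum, ← Finset.sum_add_distrib, ← Finset.sum_sub_distrib]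
  exact Finset.sum_congr rfl fun j _ ↦ by ring

theorem exists_orthogonal (hn : 2 ≤ n) (g : Fin n → ℝ) : ∃ w : E n, w ≠ 0 ∧ ∑ i, g i * w i = 0 := by
  obtain ⟨i, j, hij⟩ : ∃ i j : Fin n, i ≠ j :=
    ⟨⟨0, by omega⟩, ⟨1, by omega⟩, by simp⟩
  by_cases hg : g i = 0
  · exact ⟨EuclideanSpace.single i 1, by simp, by simp [hg]⟩
  · refine ⟨g j • EuclideanSpace.single i 1 - g i • EuclideanSpace.single j 1, fun h0 ↦ ?_, ?_⟩
    · have := congrArg (fun w : E n ↦ w j) h0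
      simp [hij.symm, hg] at this
    · simp [mul_sub, Finset.sum_sub_distrib]
      ring

end Contractions

namespace Frame

variable {b₀ : ℝ≥0∞} {A : Matrix (Fin n) (Fin n) ℝ} {B bu : Fin n → ℝ} {t : ℝ}
  (h : Frame b₀ A B bu t) {y : E n} {φ : ℝ × ℝ → ℝ}

include h

theorem hasPD_sq (hφ : ContDiffOn ℝ ∞ φ (dom b₀)) (hy : y ≠ 0) :
    HasPD (fun y ↦ (al A y * φ (t, sv A B y)) ^ 2)
      (fun i ↦ 2 * (al A y * φ (t, sv A B y)) * gradF b₀ φ A B t i y) y := by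
  have h1 := h.hasPD_al_mul hy (hφ _ (h.mem y hy))
  simp only [pow_two]
  exact (h1.mul h1).congr_grad fun i ↦ by rw [gradF]; ring

theorem hasPD_gradF (hb₀ : 0 < b₀) (hφ : ContDiffOn ℝ ∞ φ (dom b₀)) (hy : y ≠ 0) (i : Fin n) :
    HasPD (fun y ↦ 2 * (al A y * φ (t, sv A B y)) * gradF b₀ φ A B t i y)
      (fun j ↦ 2 * gTensor b₀ φ A B t i j y) y := by
  have h1 := h.hasPD_al_mul hy (hφ _ (h.mem y hy))
  have h2 := h.hasPD_al_mul₂ hb₀ hy (hφ _ (h.mem y hy)) i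
  refine ((h1.const_mul 2).mul h2).congr_grad fun j ↦ ?_
  have h0 := h.al_ne hy
  simp only [gTensor, gradF, orthForm]
  field_simp

theorem gTensor_symm (i j : Fin n) : gTensor b₀ φ A B t i j y = gTensor b₀ φ A B t j i y := by
  simp only [gTensor, h.symm i j]
  ring

theorem fundTensor_eq (hb₀ : 0 < b₀) (hφ : ContDiffOn ℝ ∞ φ (dom b₀)) (hy : y ≠ 0)
    {L : E n → E n → ℝ} {x : E n} (hL : ∀ y, L x y = al A y * φ (t, sv A B y)) (i j : Fin n) :
    fundTensor L x y i j = gTensor b₀ φ A B t i j y := by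
  rw [fundTensor, Matrix.of_apply]
  rw [pd_congr (f' := fun y ↦ 2 * (al A y * φ (t, sv A B y)) * gradF b₀ φ A B t i y),
    (h.hasPD_gradF hb₀ hφ hy i).pd_eq]
  · ring
  · filter_upwards [isOpen_ne.mem_nhds hy] with y' hy'
    simp only [hL]
    exact (h.hasPD_sq hφ hy').pd_eq i

/-! ### Contractions -/

theorem sum_bet (hy : y ≠ 0) : ∑ i, B i * y i = sv A B y * al A y := h.bet_eq hy

theorem sum_low_bu (hy : y ≠ 0) : ∑ i, low A y i * bu i = sv A B y * al A y := by
  rw [h.sum_low_mul_bu, h.bet_eq hy]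

/-- Euler's relation $g_{ij}y^j=F\,F_{y^i}$: the angular part of $g$ annihilates $y$. -/
theorem sum_gTensor_self (hy : y ≠ 0) (i : Fin n) :
    ∑ j, gTensor b₀ φ A B t i j y * y j =
      gradF b₀ φ A B t i y * (al A y * φ (t, sv A B y)) := by
  rw [sum_gTensor i (fun j ↦ y j), sum_gradF (fun j ↦ y j), sum_orthForm (fun j ↦ y j),
    h.sum_low_mul hy, h.sum_bet hy]
  have h0 := h.al_ne hy
  simp only [low]
  field_simp
  ring

/-- This contraction is the source of the denominator of $H$: lowering $b^i$ with the angular metric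
$a_{ij}-y_iy_j/\alpha^2$ gives `orthForm`, whose value on $b^i$ is $b^2-s^2$. -/
theorem sum_gTensor_bu (hy : y ≠ 0) (i : Fin n) :
    ∑ j, gTensor b₀ φ A B t i j y * bu j =
      gradF b₀ φ A B t i y * (sv A B y * φ (t, sv A B y)
        + (t - sv A B y ^ 2) * d2 b₀ φ (t, sv A B y))
      + φ (t, sv A B y) * funDelta b₀ φ (t, sv A B y) * orthForm A B i y := by
  rw [sum_gTensor, sum_gradF, sum_orthForm, h.sum_low_bu hy, h.raise, h.norm]
  have h0 := h.al_ne hy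
  simp only [orthForm, funDelta]
  field_simp
  ring

/-! ### The denominator -/

/-- The vector is the component of $b^i$ orthogonal to $y$, on which $\beta$ attains equality in
Cauchy–Schwarz. -/
theorem exists_orth_adapted (hn : 2 ≤ n) (hy : y ≠ 0) :
    ∃ w : E n, w ≠ 0 ∧ ∑ i, low A y i * w i = 0 ∧
      (∑ i, B i * w i) ^ 2 = (t - sv A B y ^ 2) * ∑ i, low A w i * w i := by
  have h0 := h.al_ne hy
  let w₀ : E n := WithLp.toLp 2 bu - (sv A B y / al A y) • y
  have hw (i) : w₀ i = bu i - sv A B y / al A y * y i := by simp [w₀]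
  have hB : ∑ i, B i * w₀ i = t - sv A B y ^ 2 := by
    have : ∑ i, B i * w₀ i = (∑ i, B i * bu i) - sv A B y / al A y * ∑ i, B i * y i := by
      simp only [hw, Finset.mul_sum, ← Finset.sum_sub_distrib]
      exact Finset.sum_congr rfl fun i _ ↦ by ring
    rw [this, h.norm, h.sum_bet hy]
    field_simp
  have hl : ∑ i, low A y i * w₀ i = 0 := by
    have : ∑ i, low A y i * w₀ i
        = (∑ i, low A y i * bu i) - sv A B y / al A y * ∑ i, low A y i * y i := by
      simp only [hw, Finset.mul_sum, ← Finset.sum_sub_distrib]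
      exact Finset.sum_congr rfl fun i _ ↦ by ring
    rw [this, h.sum_low_bu hy, h.sum_low_mul hy]
    field_simp
    ring
  have hlow (i) : low A w₀ i = B i - sv A B y / al A y * low A y i := by
    rw [← h.raise]
    simp only [low, hw, Finset.mul_sum, ← Finset.sum_sub_distrib]
    exact Finset.sum_congr rfl fun i _ ↦ by ring
  -- If $b^i$ is parallel to $y$, then $b^2=s^2$ and $\beta$ vanishes on $y^\perp$, so any nonzero
  -- vector orthogonal to $y$ serves; its existence needs $n\ge2$.
  by_cases hw0 : w₀ = 0
  · obtain ⟨w, hw1, hw2⟩ := exists_orthogonal hn (low A y)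
    have hBi (i) : B i = sv A B y / al A y * low A y i := by
      have := hlow i
      rw [hw0] at this
      simp [low] at this
      simp only [low]
      linarith
    refine ⟨w, hw1, hw2, ?_⟩
    have e1 : ∑ i, B i * w i = 0 := by
      simp only [hBi, mul_assoc, ← Finset.mul_sum, hw2, mul_zero]
    have e2 : t - sv A B y ^ 2 = 0 := by
      rw [← hB, hw0]; simp
    rw [e1, e2]; simp
  · refine ⟨w₀, hw0, hl, ?_⟩
    have : ∑ i, low A w₀ i * w₀ i
        = (∑ i, B i * w₀ i) - sv A B y / al A y * ∑ i, low A y i * w₀ i := by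
      simp only [hlow, Finset.mul_sum, ← Finset.sum_sub_distrib]
      exact Finset.sum_congr rfl fun i _ ↦ by ring
    rw [this, hl, hB]; ring

/-- Correcting the adapted vector $w$ by a multiple of $y$ puts it in the kernel of $dF$; on the
result $z$ one finds $g(z,z)=\phi\,\Delta\,\alpha(w)^2$, which must be positive. -/
theorem funDelta_ne_zero (hn : 2 ≤ n) (hφpos : ∀ q ∈ dom b₀, 0 < φ q) (hy : y ≠ 0)
    (hG : (Matrix.of fun i j ↦ gTensor b₀ φ A B t i j y).PosDef) :
    funDelta b₀ φ (t, sv A B y) ≠ 0 := by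
  obtain ⟨w, hw0, hwl, hwB⟩ := h.exists_orth_adapted hn hy
  have h0 := h.al_ne hy
  have hp := (hφpos _ (h.mem y hy)).ne'
  -- Chosen so that $F_{y^i}z^i=0$: $dF(w)=\phi_2\,\beta(w)$ because $w\perp y$, and $dF(y)=F$.
  set μ : ℝ := -(d2 b₀ φ (t, sv A B y) * ∑ i, B i * w i) / (al A y * φ (t, sv A B y)) with hμ
  let z : Fin n → ℝ := fun i ↦ w i + μ * y i
  have hlz : ∑ i, low A y i * z i = μ * al A y ^ 2 := by
    have : ∑ i, low A y i * z i = (∑ i, low A y i * w i) + μ * ∑ i, low A y i * y i := by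
      simp only [z, Finset.mul_sum, ← Finset.sum_add_distrib]
      exact Finset.sum_congr rfl fun i _ ↦ by ring
    rw [this, hwl, h.sum_low_mul hy]; ring
  have hBz : ∑ i, B i * z i = (∑ i, B i * w i) + μ * (sv A B y * al A y) := by
    rw [← h.sum_bet hy]
    simp only [z, Finset.mul_sum, ← Finset.sum_add_distrib]
    exact Finset.sum_congr rfl fun i _ ↦ by ring
  have hz : z ≠ 0 := by
    intro hz
    have hμ0 : μ = 0 := by
      have : μ * al A y ^ 2 = 0 := by rw [← hlz, hz]; simp
      simpa [h0] using this
    refine hw0 ?_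
    ext i
    have := congrFun hz i
    simpa [z, hμ0] using this
  have hF : ∑ i, gradF b₀ φ A B t i y * z i = 0 := by
    rw [sum_gradF, hlz, hBz, hμ]
    field_simp
    ring
  have ho : ∑ i, orthForm A B i y * z i = ∑ i, B i * w i := by
    rw [sum_orthForm, hlz, hBz]
    field_simp
    ring
  have hAz (i) : ∑ j, A i j * z j = low A w i + μ * low A y i := by
    simp only [z, low, Finset.mul_sum, ← Finset.sum_add_distrib]
    exact Finset.sum_congr rfl fun i _ ↦ by ring
  have key := hG.dotProduct_mulVec_pos hz
  have hsum : ∑ i, z i * ∑ j, gTensor b₀ φ A B t i j y * z j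
      = φ (t, sv A B y) * funDelta b₀ φ (t, sv A B y) * ∑ i, low A w i * w i := by
    have e1 (i) : ∑ j, gTensor b₀ φ A B t i j y * z j = φ (t, sv A B y) *
        ((φ (t, sv A B y) - sv A B y * d2 b₀ φ (t, sv A B y)) * low A w i
          + d2 b₀ (d2 b₀ φ) (t, sv A B y) * orthForm A B i y * ∑ i, B i * w i) := by
      rw [sum_gTensor, hF, ho, hlz, hAz]
      field_simp
      ring
    have e2 : ∑ i, low A w i * z i = ∑ i, low A w i * w i := by
      have : ∑ i, low A w i * y i = 0 := by
        rw [← hwl]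
        simp only [low, Finset.sum_mul]
        rw [Finset.sum_comm]
        exact Finset.sum_congr rfl fun i _ ↦ Finset.sum_congr rfl fun j _ ↦ by
          rw [h.symm]; ring
      have e : ∑ i, low A w i * z i = (∑ i, low A w i * w i) + μ * ∑ i, low A w i * y i := by
        simp only [z, Finset.mul_sum, ← Finset.sum_add_distrib]
        exact Finset.sum_congr rfl fun i _ ↦ by ring
      rw [e, this]; ring
    have e3 : ∑ i, z i * ∑ j, gTensor b₀ φ A B t i j y * z j = φ (t, sv A B y) *
        ((φ (t, sv A B y) - sv A B y * d2 b₀ φ (t, sv A B y)) * (∑ i, low A w i * z i)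
          + d2 b₀ (d2 b₀ φ) (t, sv A B y) * (∑ i, B i * w i) *
            ∑ i, orthForm A B i y * z i) := by
      generalize ∑ i, B i * w i = r at e1
      simp only [e1, Finset.mul_sum, ← Finset.sum_add_distrib]
      exact Finset.sum_congr rfl fun i _ ↦ by ring
    rw [e3, e2, ho, funDelta]
    linear_combination φ (t, sv A B y) * d2 b₀ (d2 b₀ φ) (t, sv A B y) * hwB
  intro hΔ
  have : (0 : ℝ) < ∑ i, z i * ∑ j, gTensor b₀ φ A B t i j y * z j := by
    simpa [dotProduct, Matrix.mulVec] using key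
  rw [hsum, hΔ] at this
  simp at this

end Frame

/-! ### Derivatives in $x$ and the geodesic coefficients -/

/-- A Riemannian metric `a_ij` and a `1`-form `b_i` in coordinates near `x`, with Christoffel
symbols `Γ` at `x`, such that `b_{i|j} = c a_ij` at `x`. -/
structure ConformalAt (b₀ : ℝ≥0∞) (A : E n → Matrix (Fin n) (Fin n) ℝ) (B bu : E n → Fin n → ℝ)
    (t : E n → ℝ) (Γ : Fin n → Fin n → Fin n → ℝ) (c : ℝ) (x : E n) : Prop where
  frame : ∀ᶠ x' in nhds x, Frame b₀ (A x') (B x') (bu x') (t x')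
  diffA : ∀ i j, DifferentiableAt ℝ (fun x' ↦ A x' i j) x
  diffB : ∀ i, DifferentiableAt ℝ (fun x' ↦ B x' i) x
  diffbu : ∀ i, DifferentiableAt ℝ (fun x' ↦ bu x' i) x
  christoffel_symm : ∀ k i j, Γ k i j = Γ k j i
  levi_civita : ∀ l i j, ∑ k, A x l k * Γ k i j =
    1 / 2 * (pd i (fun x' ↦ A x' l j) x + pd j (fun x' ↦ A x' l i) x
      - pd l (fun x' ↦ A x' i j) x)
  covDeriv : ∀ i j, pd j (fun x' ↦ B x' i) x = ∑ k, Γ k i j * B x k + c * A x i j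

/-- The coefficients `Γᵐ_ik yⁱ` of the nonlinear connection. -/
def nonlin (Γ : Fin n → Fin n → Fin n → ℝ) (m k : Fin n) (y : E n) : ℝ := ∑ i, Γ m i k * y i

theorem hasPD_nonlin (Γ : Fin n → Fin n → Fin n → ℝ) (m k : Fin n) (y : E n) :
    HasPD (nonlin Γ m k) (fun l ↦ Γ m l k) y :=
  (HasPD.sum fun j _ ↦ (HasPD.coord j).const_mul (Γ m j k)).congr_grad fun l ↦ by simp

namespace ConformalAt

variable {b₀ : ℝ≥0∞} {A : E n → Matrix (Fin n) (Fin n) ℝ} {B bu : E n → Fin n → ℝ}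
  {t : E n → ℝ} {Γ : Fin n → Fin n → Fin n → ℝ} {c : ℝ} {x : E n}
  (h : ConformalAt b₀ A B bu t Γ c x) {y : E n} {φ : ℝ × ℝ → ℝ}

include h

theorem frame_self : Frame b₀ (A x) (B x) (bu x) (t x) := h.frame.self_of_nhds

/-- Metric compatibility of the connection. -/
theorem sum_pd_metric (z : Fin n → ℝ) (k : Fin n) :
    ∑ i, ∑ p, pd k (fun x' ↦ A x' i p) x * z i * z p =
      2 * ∑ m, (∑ i, Γ m i k * z i) * ∑ p, A x m p * z p := by
  have e1 : ∑ m, (∑ i, Γ m i k * z i) * (∑ p, A x m p * z p)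
      = ∑ i, ∑ p, z i * z p * ∑ m, A x p m * Γ m i k := by
    simp only [Finset.sum_mul_sum]
    simp only [Finset.mul_sum]
    rw [Finset.sum_comm]
    refine Finset.sum_congr rfl fun i _ ↦ ?_
    rw [Finset.sum_comm]
    exact Finset.sum_congr rfl fun p _ ↦ Finset.sum_congr rfl fun m _ ↦ by
      rw [h.frame_self.symm p m]; ring
  have e2 (i p : Fin n) : pd k (fun x' ↦ A x' p i) x = pd k (fun x' ↦ A x' i p) x := by
    refine pd_congr k ?_
    filter_upwards [h.frame] with x' hx' using hx'.symm p i
  -- Of the three terms of the Christoffel symbol of the first kind, two are exchanged by swapping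
  -- the summation indices and cancel against the symmetric $z^iz^p$.
  have e3 : ∑ i, ∑ p, z i * z p * pd i (fun x' ↦ A x' p k) x
      = ∑ i, ∑ p, z i * z p * pd p (fun x' ↦ A x' i k) x := by
    rw [Finset.sum_comm]
    exact Finset.sum_congr rfl fun p _ ↦ Finset.sum_congr rfl fun m _ ↦ by ring
  have e4 : ∑ i, ∑ p, z i * z p * ∑ m, A x p m * Γ m i k
      = 1 / 2 * (∑ i, ∑ p, z i * z p * pd i (fun x' ↦ A x' p k) x
        + ∑ i, ∑ p, pd k (fun x' ↦ A x' i p) x * z i * z p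
        - ∑ i, ∑ p, z i * z p * pd p (fun x' ↦ A x' i k) x) := by
    simp only [Finset.mul_sum, ← Finset.sum_add_distrib, ← Finset.sum_sub_distrib]
    exact Finset.sum_congr rfl fun i _ ↦ Finset.sum_congr rfl fun p _ ↦ by
      rw [← Finset.mul_sum, h.levi_civita, e2]; ring
  rw [e1, e4, e3]; ring

theorem hasPD_low (y : E n) (i : Fin n) :
    HasPD (fun x' ↦ low (A x') y i) (fun k ↦ ∑ j, pd k (fun x' ↦ A x' i j) x * y j) x :=
  HasPD.sum fun j _ ↦ (HasPD.of_diff (h.diffA i j)).mul_const (y j)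

/-- Metric compatibility contracted with $y$: only the connection term survives, so $\alpha$ is
horizontally constant. -/
theorem hasPD_al (hy : y ≠ 0) :
    HasPD (fun x' ↦ al (A x') y)
      (fun k ↦ (∑ m, nonlin Γ m k y * low (A x) y m) / al (A x) y) x := by
  have h0 := h.frame_self.al_ne hy
  refine (HasPD.comp_deriv (Real.hasDerivAt_sqrt (h.frame_self.pos y hy).ne')
    (HasPD.sum fun j _ ↦ (h.hasPD_low y j).mul_const (y j))).congr_grad fun k ↦ ?_
  have e : ∑ j, (∑ p, pd k (fun x' ↦ A x' j p) x * y p) * y j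
      = 2 * ∑ m, nonlin Γ m k y * low (A x) y m := by
    rw [show ∑ m, nonlin Γ m k y * low (A x) y m =
      ∑ m, (∑ i, Γ m i k * y i) * ∑ p, A x m p * y p from rfl, ← h.sum_pd_metric (fun i ↦ y i)]
    simp only [Finset.sum_mul]
    exact Finset.sum_congr rfl fun i _ ↦ Finset.sum_congr rfl fun p _ ↦ by ring
  rw [e, ← al]
  field_simp

/-- The term beyond the connection is $b_{i|k}y^i=c\,y_k$. -/
theorem hasPD_bet (y : E n) :
    HasPD (fun x' ↦ bet (B x') y)
      (fun k ↦ (∑ m, nonlin Γ m k y * B x m) + c * low (A x) y k) x := by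
  refine (HasPD.sum fun j _ ↦
    (HasPD.of_diff (h.diffB j)).mul_const (y j)).congr_grad fun k ↦ ?_
  simp only [h.covDeriv, add_mul, Finset.sum_add_distrib, nonlin, low, Finset.sum_mul,
    Finset.mul_sum]
  congr 1
  · rw [Finset.sum_comm]
    exact Finset.sum_congr rfl fun i _ ↦ Finset.sum_congr rfl fun p _ ↦ by ring
  · exact Finset.sum_congr rfl fun i _ ↦ by rw [h.frame_self.symm i k]; ring

/-- This is $\partial_kb^2=2b^ib_{i|k}$. Differentiating both $b^2=b_ib^i$ and $b_i=a_{ij}b^j$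
eliminates the derivatives of $b^i$, after which metric compatibility removes those of $a_{ij}$. -/
theorem hasPD_norm : HasPD t (fun k ↦ 2 * c * B x k) x := by
  have h1 : HasPD t (fun k ↦ ∑ i, (pd k (fun x' ↦ B x' i) x * bu x i
      + B x i * pd k (fun x' ↦ bu x' i) x)) x := by
    refine HasPD.congr_fun (HasPD.sum fun i _ ↦
      (HasPD.of_diff (h.diffB i)).mul (HasPD.of_diff (h.diffbu i))) ?_
    filter_upwards [h.frame] with x' hx' using hx'.norm.symm
  have h2 (i k : Fin n) : pd k (fun x' ↦ B x' i) x
      = ∑ j, (pd k (fun x' ↦ A x' i j) x * bu x j + A x i j * pd k (fun x' ↦ bu x' j) x) := by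
    have : HasPD (fun x' ↦ B x' i) (fun k ↦ ∑ j, (pd k (fun x' ↦ A x' i j) x * bu x j
        + A x i j * pd k (fun x' ↦ bu x' j) x)) x := by
      refine HasPD.congr_fun (HasPD.sum fun j _ ↦
        (HasPD.of_diff (h.diffA i j)).mul (HasPD.of_diff (h.diffbu j))) ?_
      filter_upwards [h.frame] with x' hx' using (hx'.raise i).symm
    exact this.pd_eq k
  refine h1.congr_grad fun k ↦ ?_
  have e1 : ∑ i, B x i * pd k (fun x' ↦ bu x' i) x
      = ∑ i, bu x i * ∑ j, A x i j * pd k (fun x' ↦ bu x' j) x := by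
    simp only [← h.frame_self.raise, Finset.sum_mul, Finset.mul_sum]
    rw [Finset.sum_comm]
    exact Finset.sum_congr rfl fun i _ ↦ Finset.sum_congr rfl fun p _ ↦ by
      rw [h.frame_self.symm p i]; ring
  have e2 : ∑ i, bu x i * pd k (fun x' ↦ B x' i) x
      = ∑ i, ∑ p, pd k (fun x' ↦ A x' i p) x * bu x i * bu x p
        + ∑ i, bu x i * ∑ j, A x i j * pd k (fun x' ↦ bu x' j) x := by
    simp only [h2, Finset.mul_sum, ← Finset.sum_add_distrib]
    exact Finset.sum_congr rfl fun i _ ↦ Finset.sum_congr rfl fun p _ ↦ by ring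
  have e3 : ∑ i, bu x i * pd k (fun x' ↦ B x' i) x
      = ∑ m, (∑ i, Γ m i k * bu x i) * B x m + c * B x k := by
    simp only [h.covDeriv, mul_add, Finset.sum_add_distrib, Finset.mul_sum, Finset.sum_mul]
    congr 1
    · rw [Finset.sum_comm]
      exact Finset.sum_congr rfl fun i _ ↦ Finset.sum_congr rfl fun p _ ↦ by ring
    · rw [← h.frame_self.raise, Finset.mul_sum]
      exact Finset.sum_congr rfl fun i _ ↦ by rw [h.frame_self.symm i k]; ring
  have e4 := h.sum_pd_metric (bu x) k
  simp only [h.frame_self.raise] at e4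
  rw [Finset.sum_add_distrib, e1]
  have e5 : ∑ i, pd k (fun x' ↦ B x' i) x * bu x i
      = ∑ i, bu x i * pd k (fun x' ↦ B x' i) x :=
    Finset.sum_congr rfl fun i _ ↦ mul_comm _ _
  rw [e5]
  linarith

/-- The derivatives of `F²` in `x`: horizontal derivatives plus terms from the connection. -/
theorem hasPD_sq (hφ : ContDiffOn ℝ ∞ φ (dom b₀)) (hy : y ≠ 0) :
    HasPD (fun x' ↦ (al (A x') y * φ (t x', sv (A x') (B x') y)) ^ 2)
      (fun k ↦ ∑ m, nonlin Γ m k y * (2 * (al (A x) y * φ (t x, sv (A x) (B x) y)) *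
            gradF b₀ φ (A x) (B x) (t x) m y)
        + c * (2 * (al (A x) y * φ (t x, sv (A x) (B x) y)) *
          (2 * (al (A x) y * d1 b₀ φ (t x, sv (A x) (B x) y)) * B x k
            + d2 b₀ φ (t x, sv (A x) (B x) y) * low (A x) y k))) x := by
  have h0 := h.frame_self.al_ne hy
  have hs : HasPD (fun x' ↦ sv (A x') (B x') y) _ x :=
    (h.hasPD_bet y).div (h.hasPD_al hy) h0
  have hd : ∀ᶠ x' in nhds x, (t x', sv (A x') (B x') y) ∈ dom b₀ := by
    filter_upwards [h.frame] with x' hx' using hx'.mem y hy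
  have hf := h.hasPD_norm.comp_dom hs
    ((hφ _ (h.frame_self.mem y hy)).differentiableWithinAt (by simp)) hd
  have hp := (h.hasPD_al hy).mul hf
  simp only [pow_two]
  refine (hp.mul hp).congr_grad fun k ↦ ?_
  have e : ∑ m, nonlin Γ m k y * (2 * (al (A x) y * φ (t x, sv (A x) (B x) y)) *
        gradF b₀ φ (A x) (B x) (t x) m y)
      = 2 * (al (A x) y * φ (t x, sv (A x) (B x) y)) *
        ((φ (t x, sv (A x) (B x) y) - sv (A x) (B x) y * d2 b₀ φ (t x, sv (A x) (B x) y)) /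
            al (A x) y * (∑ m, nonlin Γ m k y * low (A x) y m)
          + d2 b₀ φ (t x, sv (A x) (B x) y) * ∑ m, nonlin Γ m k y * B x m) := by
    simp only [gradF, Finset.mul_sum, ← Finset.sum_add_distrib]
    exact Finset.sum_congr rfl fun j _ ↦ by ring
  rw [e]
  change (_ : ℝ) * (_ * φ (t x, sv (A x) (B x) y)) + _ = _
  simp only [show bet (B x) y / al (A x) y = sv (A x) (B x) y from rfl]
  field_simp
  ring

/-- The geodesic coefficients of a general `(α, β)`-metric with `b_{i|j} = c a_ij`. -/
theorem spray_eq (hb₀ : 0 < b₀) (hφ : ContDiffOn ℝ ∞ φ (dom b₀))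
    (hφpos : ∀ q ∈ dom b₀, 0 < φ q) {L : E n → E n → ℝ}
    (hL : ∀ᶠ x' in nhds x, ∀ y, L x' y = al (A x') y * φ (t x', sv (A x') (B x') y))
    (hy : y ≠ 0) (hG : (fundTensor L x y).PosDef)
    (hΔ : funDelta b₀ φ (t x, sv (A x) (B x) y) ≠ 0) (i : Fin n) :
    spray L i x y = 1 / 2 * ∑ k, nonlin Γ i k y * y k
      + c * (al (A x) y * funE b₀ φ (t x, sv (A x) (B x) y) * y i
        + al (A x) y ^ 2 * funH b₀ φ (t x, sv (A x) (B x) y) * bu x i) := by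
  have hf := h.frame_self
  have h0 := hf.al_ne hy
  have hq := hf.mem y hy
  have hpos := (hφpos _ hq).ne'
  -- the bracket in the definition of the spray
  have hx (k : Fin n) {y : E n} (hy : y ≠ 0) : pd k (fun x' ↦ L x' y ^ 2) x = _ :=
    (pd_congr k (by filter_upwards [hL] with x' hx'; rw [hx' y])).trans
      ((h.hasPD_sq hφ hy).pd_eq k)
  have h1 := hf.hasPD_al_mul hy (contDiffWithinAt_d1 hb₀ hq (hφ _ hq))
  have h2 := hf.hasPD_comp hy (contDiffWithinAt_d2 hb₀ hq (hφ _ hq))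
  have h3 := hf.hasPD_al_mul hy (hφ _ hq)
  -- `P` and `Q` are the $y^l$-derivatives of $2F\cdot2\alpha\phi_1$ and $2F\phi_2$, the
  -- coefficients of $b_k$ and $y_k$ in the $c$-part of $\partial_{x^k}F^2$; `R` is $2F\phi_2$
  -- itself, left over when $y_k$ is differentiated.
  let P : Fin n → ℝ := fun l ↦
    2 * gradF b₀ φ (A x) (B x) (t x) l y * (2 * (al (A x) y * d1 b₀ φ (t x, sv (A x) (B x) y)))
    + 2 * (al (A x) y * φ (t x, sv (A x) (B x) y)) *
      (2 * ((d1 b₀ φ (t x, sv (A x) (B x) y)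
        - sv (A x) (B x) y * d2 b₀ (d1 b₀ φ) (t x, sv (A x) (B x) y)) * low (A x) y l / al (A x) y
        + d2 b₀ (d1 b₀ φ) (t x, sv (A x) (B x) y) * B x l))
  let Q : Fin n → ℝ := fun l ↦
    2 * gradF b₀ φ (A x) (B x) (t x) l y * d2 b₀ φ (t x, sv (A x) (B x) y)
    + 2 * (al (A x) y * φ (t x, sv (A x) (B x) y)) *
      (d2 b₀ (d2 b₀ φ) (t x, sv (A x) (B x) y) * (orthForm (A x) (B x) l y / al (A x) y))
  let R : ℝ := 2 * (al (A x) y * φ (t x, sv (A x) (B x) y)) * d2 b₀ φ (t x, sv (A x) (B x) y)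
  have hxy (k l : Fin n) : pd l (fun y' ↦ pd k (fun x' ↦ L x' y' ^ 2) x) y =
      ∑ m, (Γ m l k * (2 * (al (A x) y * φ (t x, sv (A x) (B x) y)) *
          gradF b₀ φ (A x) (B x) (t x) m y)
        + nonlin Γ m k y * (2 * gTensor b₀ φ (A x) (B x) (t x) m l y))
      + c * (P l * B x k + Q l * low (A x) y k + R * A x k l) := by
    have hW := (HasPD.sum fun (m : Fin n) (_ : m ∈ Finset.univ) ↦
      (hasPD_nonlin Γ m k y).mul (hf.hasPD_gradF hb₀ hφ hy m)).add (HasPD.const_mul c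
        ((h3.const_mul 2).mul (((h1.const_mul 2).mul_const (B x k)).add
          (h2.mul (GeneralAB.hasPD_low (A x) k y)))))
    refine (pd_congr l ?_).trans ((hW.pd_eq l).trans ?_)
    · filter_upwards [isOpen_ne.mem_nhds hy] with y' hy'
      exact hx k hy'
    · simp only [P, Q, R, gradF, orthForm]
      ring
  have hg (l j : Fin n) : fundTensor L x y l j = gTensor b₀ φ (A x) (B x) (t x) l j y :=
    hf.fundTensor_eq hb₀ hφ hy hL.self_of_nhds l j
  let G : Fin n → ℝ := fun i ↦ 1 / 2 * ∑ k, nonlin Γ i k y * y k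
      + c * (al (A x) y * funE b₀ φ (t x, sv (A x) (B x) y) * y i
        + al (A x) y ^ 2 * funH b₀ φ (t x, sv (A x) (B x) y) * bu x i)
  -- Rather than inverting $g$, check that $g$ applied to the claimed coefficients is the bracket;
  -- inversion then follows from $\det g\ne0$.
  have key (l : Fin n) : 1 / 4 * (∑ k, pd l (fun y' ↦ pd k (fun x' ↦ L x' y' ^ 2) x) y * y k
      - pd l (fun x' ↦ L x' y ^ 2) x) = (fundTensor L x y).mulVec G l := by
    -- Since $\Gamma$ is symmetric, this term cancels the connection part of $[F^2]_{x^l}$.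
    have e1 : ∑ k, (∑ m, Γ m l k * (2 * (al (A x) y * φ (t x, sv (A x) (B x) y)) *
          gradF b₀ φ (A x) (B x) (t x) m y)) * y k
        = ∑ m, nonlin Γ m l y * (2 * (al (A x) y * φ (t x, sv (A x) (B x) y)) *
          gradF b₀ φ (A x) (B x) (t x) m y) := by
      simp only [nonlin, Finset.sum_mul]
      rw [Finset.sum_comm]
      exact Finset.sum_congr rfl fun m _ ↦ Finset.sum_congr rfl fun k _ ↦ by
        rw [h.christoffel_symm m l k]; ring
    have e2 : ∑ k, (∑ m, nonlin Γ m k y * (2 * gTensor b₀ φ (A x) (B x) (t x) m l y)) * y k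
        = 2 * ∑ m, gTensor b₀ φ (A x) (B x) (t x) l m y * ∑ k, nonlin Γ m k y * y k := by
      simp only [Finset.sum_mul, Finset.mul_sum]
      rw [Finset.sum_comm]
      exact Finset.sum_congr rfl fun m _ ↦ Finset.sum_congr rfl fun k _ ↦ by
        rw [hf.gTensor_symm m l]; ring
    have e3 : ∑ k, (P l * B x k + Q l * low (A x) y k + R * A x k l) * y k
        = P l * (sv (A x) (B x) y * al (A x) y) + Q l * al (A x) y ^ 2 + R * low (A x) y l := by
      rw [← hf.sum_bet hy, ← hf.sum_low_mul hy, low]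
      simp only [Finset.mul_sum, ← Finset.sum_add_distrib]
      exact Finset.sum_congr rfl fun m _ ↦ by rw [hf.symm m l]; ring
    have e4 : (fundTensor L x y).mulVec G l
        = 1 / 2 * ∑ m, gTensor b₀ φ (A x) (B x) (t x) l m y * ∑ k, nonlin Γ m k y * y k
        + c * (al (A x) y * funE b₀ φ (t x, sv (A x) (B x) y) *
            ∑ m, gTensor b₀ φ (A x) (B x) (t x) l m y * y m
          + al (A x) y ^ 2 * funH b₀ φ (t x, sv (A x) (B x) y) *
            ∑ m, gTensor b₀ φ (A x) (B x) (t x) l m y * bu x m) := by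
      have gen (g S : Fin n → ℝ) (r₁ r₂ : ℝ) :
          ∑ m, g m * (1 / 2 * S m + c * (r₁ * y m + r₂ * bu x m))
          = 1 / 2 * ∑ m, g m * S m + c * (r₁ * ∑ m, g m * y m + r₂ * ∑ m, g m * bu x m) := by
        simp only [Finset.mul_sum, ← Finset.sum_add_distrib]
        exact Finset.sum_congr rfl fun m _ ↦ by ring
      simp only [Matrix.mulVec, dotProduct, hg]
      exact gen _ (fun m ↦ ∑ k, nonlin Γ m k y * y k) _ _
    have e5 : ∑ k, pd l (fun y' ↦ pd k (fun x' ↦ L x' y' ^ 2) x) y * y k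
        = ∑ m, nonlin Γ m l y * (2 * (al (A x) y * φ (t x, sv (A x) (B x) y)) *
          gradF b₀ φ (A x) (B x) (t x) m y)
        + 2 * ∑ m, gTensor b₀ φ (A x) (B x) (t x) l m y * ∑ k, nonlin Γ m k y * y k
        + c * (P l * (sv (A x) (B x) y * al (A x) y) + Q l * al (A x) y ^ 2
          + R * low (A x) y l) := by
      rw [← e1, ← e2, ← e3, Finset.mul_sum, ← Finset.sum_add_distrib, ← Finset.sum_add_distrib]
      exact Finset.sum_congr rfl fun k _ ↦ by rw [hxy, Finset.sum_add_distrib]; ring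
    -- Cleared of denominators, the definitions of $E$ and $H$ say that the coefficients of
    -- $F_{y^l}$ and of $b_l-sy_l/\alpha$ agree on the two sides.
    have hE : funE b₀ φ (t x, sv (A x) (B x) y) * φ (t x, sv (A x) (B x) y) = _ :=
      div_mul_cancel₀ _ hpos
    have hH : funH b₀ φ (t x, sv (A x) (B x) y)
        * (2 * funDelta b₀ φ (t x, sv (A x) (B x) y)) = _ :=
      div_mul_cancel₀ _ (mul_ne_zero two_ne_zero hΔ)
    rw [e4, e5, hx l hy, hf.sum_gTensor_self hy, hf.sum_gTensor_bu hy]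
    simp only at hE hH
    have e6 : 1 / 4 * (P l * (sv (A x) (B x) y * al (A x) y) + Q l * al (A x) y ^ 2
          + R * low (A x) y l - 2 * (al (A x) y * φ (t x, sv (A x) (B x) y)) *
          (2 * (al (A x) y * d1 b₀ φ (t x, sv (A x) (B x) y)) * B x l
            + d2 b₀ φ (t x, sv (A x) (B x) y) * low (A x) y l))
        = al (A x) y ^ 2 * (gradF b₀ φ (A x) (B x) (t x) l y *
          ((d2 b₀ φ (t x, sv (A x) (B x) y)
            + 2 * sv (A x) (B x) y * d1 b₀ φ (t x, sv (A x) (B x) y)) / 2)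
          + φ (t x, sv (A x) (B x) y) * orthForm (A x) (B x) l y / 2 *
            (d2 b₀ (d2 b₀ φ) (t x, sv (A x) (B x) y) - 2 * (d1 b₀ φ (t x, sv (A x) (B x) y)
              - sv (A x) (B x) y * d2 b₀ (d1 b₀ φ) (t x, sv (A x) (B x) y)))) := by
      simp only [P, Q, R, gradF, orthForm]
      field_simp
      ring
    linear_combination c * e6 - c * al (A x) y ^ 2 * gradF b₀ φ (A x) (B x) (t x) l y * hE
      - c * al (A x) y ^ 2 * φ (t x, sv (A x) (B x) y) * orthForm (A x) (B x) l y / 2 * hH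
  have hdet : IsUnit (fundTensor L x y).det := (Matrix.isUnit_iff_isUnit_det _).1 hG.isUnit
  calc spray L i x y = ((fundTensor L x y)⁻¹.mulVec ((fundTensor L x y).mulVec G)) i := by
        rw [spray, Finset.mul_sum]
        refine Finset.sum_congr rfl fun l _ ↦ ?_
        rw [← key]
        ring
    _ = G i := by rw [Matrix.mulVec_mulVec, Matrix.nonsing_inv_mul _ hdet, Matrix.one_mulVec]

end ConformalAt

/-! ### Dimension one -/

theorem fderiv_const_mul_real (r : ℝ) (f : E n → ℝ) (y : E n) :
    fderiv ℝ (fun y ↦ r * f y) y = r • fderiv ℝ f y :=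
  congrFun (fderiv_const_smul_field (𝕜 := ℝ) (f := f) r) y

/-- No differentiability is needed: for a nonzero scalar the rules for `fderiv` under scaling hold
unconditionally, default values included. -/
theorem pd_of_homogeneous {f : E n → ℝ} {r : ℝ} (hr : r ≠ 0) (k : ℕ)
    (hf : ∀ y, f (r • y) = r ^ (k + 1) * f y) (i : Fin n) (y : E n) :
    pd i f (r • y) = r ^ k * pd i f y := by
  have h1 : fderiv ℝ (fun y ↦ f (r • y)) y = r • fderiv ℝ f (r • y) := fderiv_comp_smul ..
  have h2 : fderiv ℝ (fun y ↦ f (r • y)) y = r ^ (k + 1) • fderiv ℝ f y := by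
    simp only [hf]
    exact fderiv_const_mul_real ..
  have h3 := congrArg (fun T ↦ T (EuclideanSpace.single i 1)) (h1.symm.trans h2)
  simp only [FunLike.coe_smul, Pi.smul_apply, smul_eq_mul] at h3
  rw [pow_succ', mul_assoc] at h3
  exact mul_left_cancel₀ hr h3

theorem spray_smul {L : E n → E n → ℝ} {r : ℝ} (hr : r ≠ 0)
    (hL : ∀ x y, L x (r • y) = r * L x y) (i : Fin n) (x y : E n) :
    spray L i x (r • y) = r ^ 2 * spray L i x y := by
  have hsq (x y) : L x (r • y) ^ 2 = r ^ (1 + 1) * L x y ^ 2 := by rw [hL]; ring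
  have h1 (i y) := pd_of_homogeneous (f := fun y ↦ L x y ^ 2) hr 1 (hsq x) i y
  have hg : fundTensor L x (r • y) = fundTensor L x y := by
    ext i j
    simp only [fundTensor, Matrix.of_apply]
    rw [pd_of_homogeneous hr 0 (h1 i), pow_zero, one_mul]
  have hx (k : Fin n) (y : E n) :
      pd k (fun x' ↦ L x' (r • y) ^ 2) x = r ^ (1 + 1) * pd k (fun x' ↦ L x' y ^ 2) x := by
    simp only [hsq, pd]
    rw [fderiv_const_mul_real]
    rfl
  have hxy (k l : Fin n) :=
    pd_of_homogeneous (f := fun y ↦ pd k (fun x' ↦ L x' y ^ 2) x) hr 1 (hx k) l y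
  simp only [spray, hg, hx, hxy, Finset.mul_sum, mul_sub]
  refine Finset.sum_congr rfl fun l _ ↦ ?_
  congr 1
  · exact Finset.sum_congr rfl fun k _ ↦ by simp; ring
  · ring

/-- On the half-line through $y$ the 2-homogeneous $G$ is a constant times $y^2$, so
$G-\frac12G'y=0$ there. Neither smoothness nor a nonzero $\Delta$ is required. -/
theorem douglas_eq_zero_of_dim_one {L : E 1 → E 1 → ℝ}
    (hL : ∀ x y r, 0 < r → L x (r • y) = r * L x y) {x y : E 1} (hy : y ≠ 0)
    (i j k l : Fin 1) : douglas L i j k l x y = 0 := by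
  have hy0 : y 0 ≠ 0 := fun h0 ↦ hy (by ext i; rw [Subsingleton.elim i 0, h0]; rfl)
  have hU : IsOpen {z : E 1 | 0 < z 0 / y 0} := isOpen_lt (by fun_prop) (by fun_prop)
  have hyU : y ∈ {z : E 1 | 0 < z 0 / y 0} := by simp [hy0]
  have hs {z : E 1} (hz : z ∈ {z : E 1 | 0 < z 0 / y 0}) (i : Fin 1) :
      spray L i x z = spray L 0 x y / y 0 ^ 2 * (z 0 * z 0) := by
    have e : z = (z 0 / y 0) • y := by
      ext m
      rw [Subsingleton.elim m 0]
      simp [hy0]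
    have hz' : 0 < z 0 / y 0 := hz
    rw [Subsingleton.elim i 0, e, spray_smul hz'.ne' fun x y ↦ hL x y _ hz']
    simp
    field_simp
  have hev {z : E 1} (hz : z ∈ {z : E 1 | 0 < z 0 / y 0}) := hU.mem_nhds hz
  have hp {z : E 1} (hz : z ∈ {z : E 1 | 0 < z 0 / y 0}) (m : Fin 1) :
      pd m (fun y' ↦ spray L m x y') z = spray L 0 x y / y 0 ^ 2 * (2 * z 0) := by
    have := (((HasPD.coord (x := z) (0 : Fin 1)).mul (HasPD.coord 0)).const_mul
      (spray L 0 x y / y 0 ^ 2)).congr_fun (f' := fun y' ↦ spray L m x y')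
      (by filter_upwards [hev hz] with z' hz' using hs hz' m)
    rw [this.pd_eq, Subsingleton.elim m 0]
    simp only [if_true]
    ring
  have h0 {z : E 1} (hz : z ∈ {z : E 1 | 0 < z 0 / y 0}) : spray L i x z
      - 1 / (((1 : ℕ) : ℝ) + 1) * (∑ m, pd m (fun y' ↦ spray L m x y') z) * z i = 0 := by
    simp only [hs hz, hp hz, Subsingleton.elim i 0]
    simp
    ring
  have hc {f : E 1 → ℝ} (hf : ∀ z ∈ {z : E 1 | 0 < z 0 / y 0}, f z = 0) (m : Fin 1) :
      ∀ z ∈ {z : E 1 | 0 < z 0 / y 0}, pd m f z = 0 := fun z hz ↦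
    ((HasPD.const 0).congr_fun (by filter_upwards [hev hz] with z' hz' using hf z' hz')).pd_eq m
  exact hc (hc (hc (fun z hz ↦ h0 hz) j) k) l y hyU

/-! ### The Douglas tensor -/

/-- The quadratic part contributes nothing at third order, so only the Leibniz expansion of $X\,y^i$
and the derivatives of $Z$ remain. For the Douglas tensor $X=\alpha T$, $Z=\alpha^2H$, $d=b^i$. -/
theorem pd_pd_pd_eq {X Z : E n → ℝ} {X₁ Z₁ : Fin n → E n → ℝ} {X₂ Z₂ : Fin n → Fin n → E n → ℝ}
    {X₃ Z₃ : Fin n → Fin n → Fin n → E n → ℝ} {f : E n → ℝ} {Γ : Fin n → Fin n → Fin n → ℝ}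
    {τ : Fin n → ℝ} {r c d : ℝ} {i : Fin n} (hΓ : ∀ k i j, Γ k i j = Γ k j i)
    (hX : ∀ y, y ≠ 0 → HasPD X (fun j ↦ X₁ j y) y)
    (hX₁ : ∀ y, y ≠ 0 → ∀ j, HasPD (X₁ j) (fun k ↦ X₂ j k y) y)
    (hX₂ : ∀ y, y ≠ 0 → ∀ j k, HasPD (X₂ j k) (fun l ↦ X₃ j k l y) y)
    (hZ : ∀ y, y ≠ 0 → HasPD Z (fun j ↦ Z₁ j y) y)
    (hZ₁ : ∀ y, y ≠ 0 → ∀ j, HasPD (Z₁ j) (fun k ↦ Z₂ j k y) y)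
    (hZ₂ : ∀ y, y ≠ 0 → ∀ j k, HasPD (Z₂ j k) (fun l ↦ Z₃ j k l y) y)
    (hf : ∀ y, y ≠ 0 → f y = (1 / 2 * ∑ k, nonlin Γ i k y * y k - r * (bet τ y * y i))
      + c * (X y * y i + Z y * d)) {y : E n} (hy : y ≠ 0) (j k l : Fin n) :
    pd l (pd k (pd j f)) y =
      c * (X₃ j k l y * y i + X₂ j k y * (if i = l then 1 else 0)
        + X₂ j l y * (if i = k then 1 else 0) + X₂ k l y * (if i = j then 1 else 0)
        + Z₃ j k l y * d) := by
  have hev {y : E n} (hy : y ≠ 0) := isOpen_ne.mem_nhds hy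
  have hq (y : E n) : HasPD (fun y ↦ 1 / 2 * ∑ k, nonlin Γ i k y * y k) (nonlin Γ i · y) y := by
    refine ((HasPD.sum fun k _ ↦ (hasPD_nonlin Γ i k y).mul (HasPD.coord k)).const_mul
      (1 / 2)).congr_grad fun l ↦ ?_
    simp only [Finset.sum_add_distrib, mul_ite, mul_one, mul_zero, Finset.sum_ite_eq',
      Finset.mem_univ, if_true]
    rw [show ∑ k, Γ i l k * y k = nonlin Γ i l y from
      Finset.sum_congr rfl fun k _ ↦ by rw [hΓ]]
    ring
  have h1 {y : E n} (hy : y ≠ 0) (j : Fin n) : pd j f y = nonlin Γ i j y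
      - r * (τ j * y i + bet τ y * (if i = j then 1 else 0))
      + c * (X₁ j y * y i + X y * (if i = j then 1 else 0) + Z₁ j y * d) :=
    HasPD.pd_eq (((((hq y).sub (((hasPD_bet τ y).mul (HasPD.coord i)).const_mul r)).add
      ((((hX y hy).mul (HasPD.coord i)).add ((hZ y hy).mul_const d)).const_mul c))).congr_fun
      (by filter_upwards [hev hy] with y' hy' using hf y' hy')) j
  have h2 {y : E n} (hy : y ≠ 0) (j k : Fin n) : pd k (pd j f) y = Γ i k j
      - r * (τ j * (if i = k then 1 else 0) + τ k * (if i = j then 1 else 0))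
      + c * (X₂ j k y * y i + X₁ j y * (if i = k then 1 else 0)
        + X₁ k y * (if i = j then 1 else 0) + Z₂ j k y * d) := by
    have := ((((hasPD_nonlin Γ i j y).sub ((((HasPD.coord i).const_mul (τ j)).add
      ((hasPD_bet τ y).mul_const (if i = j then 1 else 0))).const_mul r)).add
      (((((hX₁ y hy j).mul (HasPD.coord i)).add ((hX y hy).mul_const (if i = j then 1 else 0))).add
        ((hZ₁ y hy j).mul_const d)).const_mul c))).congr_fun
      (by filter_upwards [hev hy] with y' hy' using h1 hy' j)
    rw [this.pd_eq]
  have := (((HasPD.const (Γ i k j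
      - r * (τ j * (if i = k then 1 else 0) + τ k * (if i = j then 1 else 0)))).add
    ((((((hX₂ y hy j k).mul (HasPD.coord i)).add
      ((hX₁ y hy j).mul_const (if i = k then 1 else 0))).add
      ((hX₁ y hy k).mul_const (if i = j then 1 else 0))).add
        ((hZ₂ y hy j k).mul_const d)).const_mul c))).congr_fun
      (by filter_upwards [hev hy] with y' hy' using h2 hy' j k)
  rw [this.pd_eq]
  ring

namespace Frame

variable {b₀ : ℝ≥0∞} {A : Matrix (Fin n) (Fin n) ℝ} {B bu : Fin n → ℝ} {t : ℝ}
  (h : Frame b₀ A B bu t) {y : E n}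

include h

/-- The first derivatives of `α² f(b², s)`. -/
theorem hasPD_al_sq_mul {f : ℝ × ℝ → ℝ} (hy : y ≠ 0)
    (hf : ContDiffWithinAt ℝ ∞ f (dom b₀) (t, sv A B y)) :
    HasPD (fun y ↦ al A y ^ 2 * f (t, sv A B y))
      (fun j ↦ (2 * f (t, sv A B y) - sv A B y * d2 b₀ f (t, sv A B y)) * low A y j
        + al A y * d2 b₀ f (t, sv A B y) * B j) y := by
  simp only [pow_two]
  refine (((h.hasPD_al hy).mul (h.hasPD_al hy)).mul (h.hasPD_comp hy hf)).congr_grad fun l ↦ ?_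
  have h0 := h.al_ne hy
  field_simp
  ring

/-- The second derivatives of `α² f(b², s)`. -/
theorem hasPD_al_sq_mul₂ (hb₀ : 0 < b₀) {f : ℝ × ℝ → ℝ} (hy : y ≠ 0)
    (hf : ContDiffWithinAt ℝ ∞ f (dom b₀) (t, sv A B y)) (j : Fin n) :
    HasPD (fun y ↦ (2 * f (t, sv A B y) - sv A B y * d2 b₀ f (t, sv A B y)) * low A y j
        + al A y * d2 b₀ f (t, sv A B y) * B j)
      (fun k ↦ (2 * f (t, sv A B y) - sv A B y * d2 b₀ f (t, sv A B y)) * A j k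
        + (d2 b₀ f (t, sv A B y) - sv A B y * d2 b₀ (d2 b₀ f) (t, sv A B y)) / al A y *
          (low A y j * B k + low A y k * B j - sv A B y / al A y * low A y j * low A y k)
        + d2 b₀ (d2 b₀ f) (t, sv A B y) * B j * B k) y := by
  have hf2 := contDiffWithinAt_d2 hb₀ (h.mem y hy) hf
  refine (((((h.hasPD_comp hy hf).const_mul 2).sub
    ((h.hasPD_sv hy).mul (h.hasPD_comp hy hf2))).mul (hasPD_low A j y)).add
    (((h.hasPD_al hy).mul (h.hasPD_comp hy hf2)).mul_const (B j))).congr_grad fun l ↦ ?_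
  have h0 := h.al_ne hy
  field_simp
  ring

/-- The third derivatives of `α² f(b², s)`. -/
theorem hasPD_al_sq_mul₃ (hb₀ : 0 < b₀) {f : ℝ × ℝ → ℝ} (hy : y ≠ 0)
    (hf : ContDiffWithinAt ℝ ∞ f (dom b₀) (t, sv A B y)) (j k : Fin n) :
    HasPD (fun y ↦ (2 * f (t, sv A B y) - sv A B y * d2 b₀ f (t, sv A B y)) * A j k
        + (d2 b₀ f (t, sv A B y) - sv A B y * d2 b₀ (d2 b₀ f) (t, sv A B y)) / al A y *
          (low A y j * B k + low A y k * B j - sv A B y / al A y * low A y j * low A y k)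
        + d2 b₀ (d2 b₀ f) (t, sv A B y) * B j * B k)
      (fun l ↦ 1 / al A y *
        ((d2 b₀ f (t, sv A B y) - sv A B y * d2 b₀ (d2 b₀ f) (t, sv A B y)) *
          ((B j - sv A B y / al A y * low A y j) * A k l
            + (B k - sv A B y / al A y * low A y k) * A j l
            + (B l - sv A B y / al A y * low A y l) * A j k)
        - 1 / al A y ^ 2 * (d2 b₀ f (t, sv A B y) - sv A B y * d2 b₀ (d2 b₀ f) (t, sv A B y)
            - sv A B y ^ 2 * d2 b₀ (d2 b₀ (d2 b₀ f)) (t, sv A B y)) *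
          (B l * low A y j * low A y k + B j * low A y k * low A y l
            + B k * low A y l * low A y j)
        - sv A B y * d2 b₀ (d2 b₀ (d2 b₀ f)) (t, sv A B y) / al A y *
          (B k * B l * low A y j + B l * B j * low A y k + B j * B k * low A y l)
        + sv A B y / al A y ^ 3 * (3 * d2 b₀ f (t, sv A B y)
            - 3 * sv A B y * d2 b₀ (d2 b₀ f) (t, sv A B y)
            - sv A B y ^ 2 * d2 b₀ (d2 b₀ (d2 b₀ f)) (t, sv A B y)) *
          low A y j * low A y k * low A y l
        + d2 b₀ (d2 b₀ (d2 b₀ f)) (t, sv A B y) * B j * B k * B l)) y := by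
  have hf2 := contDiffWithinAt_d2 hb₀ (h.mem y hy) hf
  have hf22 := contDiffWithinAt_d2 hb₀ (h.mem y hy) hf2
  have g0 := h.hasPD_comp hy hf
  have g2 := h.hasPD_comp hy hf2
  have g22 := h.hasPD_comp hy hf22
  have gs := h.hasPD_sv hy
  have ga := h.hasPD_al hy
  have h0 := h.al_ne hy
  refine (((((g0.const_mul 2).sub (gs.mul g2)).mul_const (A j k)).add
    (((g2.sub (gs.mul g22)).div ga h0).mul
      ((((hasPD_low A j y).mul_const (B k)).add ((hasPD_low A k y).mul_const (B j))).sub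
        (((gs.div ga h0).mul (hasPD_low A j y)).mul (hasPD_low A k y))))).add
    ((g22.mul_const (B j)).mul_const (B k))).congr_grad fun l ↦ ?_
  field_simp
  ring

end Frame

/-- The right-hand side of the formula for the Douglas tensor. -/
def douglasFormula (C α s : ℝ) (a : Matrix (Fin n) (Fin n) ℝ) (b bu yl y : Fin n → ℝ)
    (δ : Fin n → Fin n → ℝ) (T T2 T22 T222 H2 H22 H222 : ℝ) (i j k l : Fin n) : ℝ :=
  C / α * cyc (fun j k l ↦
      ((T - s * T2) * a k l + T22 * b l * b k) * δ i j
      + 1 / α ^ 2 * (s / α * (3 * T22 + s * T222) * yl l * yl j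
          - (T22 + s * T222) * b l * yl j) * b k * y i) j k l
  - C / α ^ 2 * cyc (fun j k l ↦
      s * T22 * ((yl k * b l + yl l * b k) * δ i j + a j l * b k * y i)
      + 1 / α * (T - s * T2 - s ^ 2 * T22) * (yl l * δ i j + a l j * y i) * yl k) j k l
  + C / α ^ 2 * (1 / α ^ 3 * (3 * T - 3 * s * T2 - 6 * s ^ 2 * T22 - s ^ 3 * T222)
        * yl k * yl j * yl l
      + T222 * b l * b k * b j) * y i
  + C / α * cyc (fun j k l ↦
      ((H2 - s * H22) * (b j - s / α * yl j) * a k l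
        - 1 / α ^ 2 * (H2 - s * H22 - s ^ 2 * H222) * b l * yl j * yl k
        - s * H222 / α * b k * b l * yl j) * bu i) j k l
  + C / α * (s / α ^ 3 * (3 * H2 - 3 * s * H22 - s ^ 2 * H222) * yl j * yl k * yl l
      + H222 * b l * b k * b j) * bu i

/-- In dimension one the right-hand side vanishes identically. -/
theorem douglasFormula_eq_zero {b₀ : ℝ≥0∞} {A : Matrix (Fin 1) (Fin 1) ℝ} {B bu : Fin 1 → ℝ}
    {t : ℝ} (h : Frame b₀ A B bu t) {y : E 1} (hy : y ≠ 0)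
    (C T T2 T22 T222 H2 H22 H222 : ℝ) (i j k l : Fin 1) :
    douglasFormula C (al A y) (sv A B y) A B bu (low A y) (fun i ↦ y i)
      (fun i j ↦ if i = j then 1 else 0) T T2 T22 T222 H2 H22 H222 i j k l = 0 := by
  have h0 := h.al_ne hy
  have hy0 : y 0 ≠ 0 := fun h0 ↦ hy (by ext i; rw [Subsingleton.elim i 0, h0]; rfl)
  have e1 := h.sum_low_mul hy
  have e2 := h.sum_bet hy
  have e3 := h.sum_low_bu hy
  have e4 : low A y 0 = A 0 0 * y 0 := by simp [low]
  simp only [Fin.sum_univ_one, Fin.isValue] at e1 e2 e3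
  -- In dimension one every component is a monomial in $\alpha$, $s$ and $y$, and the formula
  -- becomes an identity in which $T$, $H$ and their derivatives are free.
  have f1 : low A y 0 = al A y ^ 2 / y 0 := by rw [← e1]; field_simp
  have f2 : B 0 = sv A B y * al A y / y 0 := by rw [← e2]; field_simp
  have f4 : A 0 0 = al A y ^ 2 / y 0 ^ 2 := by rw [← e1, e4]; field_simp
  have f3 : bu 0 = sv A B y * y 0 / al A y := by
    rw [f1] at e3
    field_simp at e3 ⊢
    linarith
  simp only [douglasFormula, cyc, Subsingleton.elim i 0, Subsingleton.elim j 0,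
    Subsingleton.elim k 0, Subsingleton.elim l 0, if_true]
  generalize sv A B y = s at *
  generalize al A y = α at *
  rw [f1, f2, f3, f4]
  field_simp
  ring

namespace ConformalAt

variable {b₀ : ℝ≥0∞} {A : E n → Matrix (Fin n) (Fin n) ℝ} {B bu : E n → Fin n → ℝ}
  {t : E n → ℝ} {Γ : Fin n → Fin n → Fin n → ℝ} {c : ℝ} {x : E n}
  (h : ConformalAt b₀ A B bu t Γ c x) {y : E n} {φ : ℝ × ℝ → ℝ}

include h

/-- Since $\alpha E$ is 1-homogeneous, the divergence of $\alpha E\,y^i$ is $(n+1)\alpha E$; that of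
$\alpha^2H\,b^i$ is $-(n+1)\alpha T$, which accounts for the definition of $T$. -/
theorem sum_pd_spray (hb₀ : 0 < b₀) (hφ : ContDiffOn ℝ ∞ φ (dom b₀))
    (hφpos : ∀ q ∈ dom b₀, 0 < φ q) {L : E n → E n → ℝ}
    (hL : ∀ᶠ x' in nhds x, ∀ y, L x' y = al (A x') y * φ (t x', sv (A x') (B x') y))
    (hG : ∀ y, y ≠ 0 → (fundTensor L x y).PosDef)
    (hΔ : ∀ y, y ≠ 0 → funDelta b₀ φ (t x, sv (A x) (B x) y) ≠ 0) (hy : y ≠ 0) :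
    ∑ m, pd m (fun y' ↦ spray L m x y') y = bet (fun k ↦ ∑ m, Γ m m k) y
      + c * ((n + 1) * (al (A x) y * funE b₀ φ (t x, sv (A x) (B x) y)
        - al (A x) y * funT n b₀ φ (t x, sv (A x) (B x) y))) := by
  have hf := h.frame_self
  have hq := hf.mem y hy
  have hE := contDiffWithinAt_funE hb₀ hq (hφ _ hq) (hΔ y hy) (hφpos _ hq).ne'
  have hH := contDiffWithinAt_funH hb₀ hq (hφ _ hq) (hΔ y hy)
  have hpd (m : Fin n) : pd m (fun y' ↦ spray L m x y') y = nonlin Γ m m y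
      + c * (gradF b₀ (funE b₀ φ) (A x) (B x) (t x) m y * y m
        + al (A x) y * funE b₀ φ (t x, sv (A x) (B x) y)
        + ((2 * funH b₀ φ (t x, sv (A x) (B x) y)
            - sv (A x) (B x) y * d2 b₀ (funH b₀ φ) (t x, sv (A x) (B x) y)) * low (A x) y m
          + al (A x) y * d2 b₀ (funH b₀ φ) (t x, sv (A x) (B x) y) * B x m) * bu x m) := by
    have hd := (((HasPD.sum fun (k : Fin n) (_ : k ∈ Finset.univ) ↦
      (hasPD_nonlin Γ m k y).mul (HasPD.coord k)).const_mul (1 / 2)).add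
      ((((hf.hasPD_al_mul hy hE).mul (HasPD.coord m)).add
        ((hf.hasPD_al_sq_mul hy hH).mul_const (bu x m))).const_mul c)).congr_fun
      (f' := fun y' ↦ spray L m x y') (by
        filter_upwards [isOpen_ne.mem_nhds hy] with y' hy' using
          h.spray_eq hb₀ hφ hφpos hL hy' (hG y' hy') (hΔ y' hy') m)
    rw [hd.pd_eq]
    simp only [Finset.sum_add_distrib, mul_ite, mul_one, mul_zero, Finset.sum_ite_eq',
      Finset.mem_univ, if_true, gradF]
    rw [show ∑ k, Γ m m k * y k = nonlin Γ m m y from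
      Finset.sum_congr rfl fun k _ ↦ by rw [h.christoffel_symm]]
    ring
  have e1 : ∑ m, nonlin Γ m m y = bet (fun k ↦ ∑ m, Γ m m k) y := by
    simp only [nonlin, bet, Finset.sum_mul]
    rw [Finset.sum_comm]
    exact Finset.sum_congr rfl fun k _ ↦ Finset.sum_congr rfl fun m _ ↦ by
      rw [h.christoffel_symm]
  have e2 : ∑ m, ((2 * funH b₀ φ (t x, sv (A x) (B x) y)
            - sv (A x) (B x) y * d2 b₀ (funH b₀ φ) (t x, sv (A x) (B x) y)) * low (A x) y m
          + al (A x) y * d2 b₀ (funH b₀ φ) (t x, sv (A x) (B x) y) * B x m) * bu x m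
      = -((n + 1) * (al (A x) y * funT n b₀ φ (t x, sv (A x) (B x) y))) := by
    simp only [add_mul, Finset.sum_add_distrib, mul_assoc, ← Finset.mul_sum]
    rw [hf.sum_low_bu hy, hf.norm, funT]
    have : (n : ℝ) + 1 ≠ 0 := by positivity
    field_simp
    ring
  have h0 := hf.al_ne hy
  simp only [hpd, Finset.sum_add_distrib, ← Finset.mul_sum, e1, e2]
  rw [sum_gradF (fun j ↦ y j), hf.sum_low_mul hy, hf.sum_bet hy]
  simp only [Finset.sum_const, Finset.card_univ, Fintype.card_fin, nsmul_eq_mul]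
  field_simp
  ring

/-- The Douglas tensor of a general `(α, β)`-metric with `b_{i|j} = c a_ij`. -/
theorem douglas_eq (hb₀ : 0 < b₀) (hφ : ContDiffOn ℝ ∞ φ (dom b₀))
    (hφpos : ∀ q ∈ dom b₀, 0 < φ q) {L : E n → E n → ℝ}
    (hL : ∀ᶠ x' in nhds x, ∀ y, L x' y = al (A x') y * φ (t x', sv (A x') (B x') y))
    (hhom : ∀ x y r, 0 < r → L x (r • y) = r * L x y)
    (hG : ∀ y, y ≠ 0 → (fundTensor L x y).PosDef) (hy : y ≠ 0) (i j k l : Fin n) :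
    douglas L i j k l x y =
      douglasFormula c (al (A x) y) (sv (A x) (B x) y) (A x) (B x) (bu x) (low (A x) y)
        (fun i ↦ y i) (fun i j ↦ if i = j then 1 else 0)
        (funT n b₀ φ (t x, sv (A x) (B x) y))
        (d2 b₀ (funT n b₀ φ) (t x, sv (A x) (B x) y))
        (d2 b₀ (d2 b₀ (funT n b₀ φ)) (t x, sv (A x) (B x) y))
        (d2 b₀ (d2 b₀ (d2 b₀ (funT n b₀ φ))) (t x, sv (A x) (B x) y))
        (d2 b₀ (funH b₀ φ) (t x, sv (A x) (B x) y))
        (d2 b₀ (d2 b₀ (funH b₀ φ)) (t x, sv (A x) (B x) y))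
        (d2 b₀ (d2 b₀ (d2 b₀ (funH b₀ φ))) (t x, sv (A x) (B x) y)) i j k l := by
  have hf := h.frame_self
  -- For $n=1$ the denominator of $H$ may vanish, so both sides are shown to be zero separately.
  rcases Nat.lt_or_ge n 2 with hn | hn
  · interval_cases n
    · exact i.elim0
    · rw [douglas_eq_zero_of_dim_one hhom hy, douglasFormula_eq_zero hf hy]
  have hΔ (y : E n) (hy : y ≠ 0) : funDelta b₀ φ (t x, sv (A x) (B x) y) ≠ 0 := by
    refine hf.funDelta_ne_zero hn hφpos hy ?_
    convert hG y hy using 1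
    ext i j
    exact (hf.fundTensor_eq hb₀ hφ hy hL.self_of_nhds i j).symm
  have hH (y : E n) (hy : y ≠ 0) := contDiffWithinAt_funH hb₀ (hf.mem y hy)
    (hφ _ (hf.mem y hy)) (hΔ y hy)
  have hT (y : E n) (hy : y ≠ 0) := contDiffWithinAt_funT (n := n) hb₀ (hf.mem y hy)
    (hφ _ (hf.mem y hy)) (hΔ y hy)
  have hnn : (n : ℝ) + 1 ≠ 0 := by positivity
  have key := pd_pd_pd_eq (i := i) (c := c) (d := bu x i) (r := 1 / ((n : ℝ) + 1))
    (τ := fun k ↦ ∑ m, Γ m m k)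
    (f := fun y₀ ↦ spray L i x y₀
      - 1 / ((n : ℝ) + 1) * (∑ m, pd m (fun y' ↦ spray L m x y') y₀) * y₀ i)
    h.christoffel_symm
    (fun y hy ↦ hf.hasPD_al_mul hy (hT y hy))
    (fun y hy j ↦ hf.hasPD_al_mul₂ hb₀ hy (hT y hy) j)
    (fun y hy j k ↦ hf.hasPD_al_mul₃ hb₀ hy (hT y hy) j k)
    (fun y hy ↦ hf.hasPD_al_sq_mul hy (hH y hy))
    (fun y hy j ↦ hf.hasPD_al_sq_mul₂ hb₀ hy (hH y hy) j)
    (fun y hy j k ↦ hf.hasPD_al_sq_mul₃ hb₀ hy (hH y hy) j k)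
    (fun y hy ↦ by
      rw [h.spray_eq hb₀ hφ hφpos hL hy (hG y hy) (hΔ y hy) i,
        h.sum_pd_spray hb₀ hφ hφpos hL hG hΔ hy]
      field_simp
      ring) hy j k l
  refine key.trans ?_
  have h0 := hf.al_ne hy
  -- The cyclic sums produce $a$ with its indices in both orders; symmetry normalises them before
  -- the comparison.
  simp only [douglasFormula, cyc, hf.symm l j, hf.symm k j, hf.symm l k]
  generalize (if i = j then (1 : ℝ) else 0) = δj
  generalize (if i = k then (1 : ℝ) else 0) = δk
  generalize (if i = l then (1 : ℝ) else 0) = δl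
  field_simp
  ring

end ConformalAt

/-! ### From the manifold to local coordinates -/

section Charts

variable {M : Type*} [TopologicalSpace M] [ChartedSpace (E n) M]

theorem mdifferentiable_of_mem_maximalAtlas {e : OpenPartialHomeomorph M (E n)}
    (he : e ∈ IsManifold.maximalAtlas (𝓡 n) ∞ M) : e.MDifferentiable (𝓡 n) 𝓘(ℝ, E n) :=
  ⟨(contMDiffOn_of_mem_maximalAtlas he).mdifferentiableOn (by simp),
    (contMDiffOn_symm_of_mem_maximalAtlas he).mdifferentiableOn (by simp)⟩

theorem coordVec_bijective [IsManifold (𝓡 n) ∞ M] {e : OpenPartialHomeomorph M (E n)}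
    (he : e ∈ IsManifold.maximalAtlas (𝓡 n) ∞ M) {x : E n} (hx : x ∈ e.target) :
    Function.Bijective (coordVec e x) :=
  (mdifferentiable_of_mem_maximalAtlas he).symm.mfderiv_bijective hx

/-- The linear map `y ↦ ∑ i, y i • ∂/∂xⁱ`. -/
def coordLin (e : OpenPartialHomeomorph M (E n)) (x : E n) :
    E n →ₗ[ℝ] TangentSpace (𝓡 n) (e.symm x) :=
  (mfderiv 𝓘(ℝ, E n) (𝓡 n) e.symm x).toLinearMap

theorem coordLin_apply (e : OpenPartialHomeomorph M (E n)) (x y : E n) :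
    coordLin e x y = coordVec e x y := rfl

theorem coordVec_eq_sum (e : OpenPartialHomeomorph M (E n)) (x y : E n) :
    coordVec e x y = ∑ i, y i • coordVec e x (EuclideanSpace.single i 1) := by
  have h : y = ∑ i, y i • EuclideanSpace.single i (1 : ℝ) := by
    ext j
    simp [Pi.single_apply]
  simp only [← coordLin_apply]
  conv_lhs => rw [h]
  simp only [map_sum, map_smul]

theorem coordVec_ne_zero [IsManifold (𝓡 n) ∞ M] {e : OpenPartialHomeomorph M (E n)}
    (he : e ∈ IsManifold.maximalAtlas (𝓡 n) ∞ M) {x : E n} (hx : x ∈ e.target) {y : E n}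
    (hy : y ≠ 0) : coordVec e x y ≠ 0 := fun h ↦
  hy ((coordVec_bijective he hx).1 (h.trans (map_zero (coordLin e x)).symm))

/-- The coordinate vector fields are smooth. -/
theorem contMDiffAt_coordVec [IsManifold (𝓡 n) ∞ M] {e : OpenPartialHomeomorph M (E n)}
    (he : e ∈ IsManifold.maximalAtlas (𝓡 n) ∞ M) {x : E n} (hx : x ∈ e.target) (y : E n) :
    ContMDiffAt 𝓘(ℝ, E n) ((𝓡 n).prod 𝓘(ℝ, E n)) ∞
      (fun x' ↦ TotalSpace.mk' (E n) (E := fun p : M ↦ TangentSpace (𝓡 n) p)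
        (e.symm x') (coordVec e x' y)) x := by
  have hs : ContMDiffAt 𝓘(ℝ, E n) (𝓡 n) ∞ e.symm x := contMDiffAt_symm_of_mem_maximalAtlas he hx
  have h1 := hs.mfderiv_const (m := ∞) (by simp)
  have h2 : ContMDiffAt 𝓘(ℝ, E n) (𝓘(ℝ, E n).prod 𝓘(ℝ, E n)) ∞
      (fun x' ↦ TotalSpace.mk' (E n) (E := fun p : E n ↦ TangentSpace 𝓘(ℝ, E n) p) x' y) x :=
    contMDiffAt_vectorSpace_iff_contDiffAt.2 contDiffAt_const
  exact ContMDiffAt.clm_apply_of_inCoordinates (b₁ := id) (b₂ := e.symm)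
    (E₁ := fun p : E n ↦ TangentSpace 𝓘(ℝ, E n) p) (E₂ := fun p : M ↦ TangentSpace (𝓡 n) p)
    (F₁ := E n) (F₂ := E n) (ϕ := fun x' ↦ mfderiv 𝓘(ℝ, E n) (𝓡 n) e.symm x') h1 h2 hs

theorem bet_formCoef (e : OpenPartialHomeomorph M (E n))
    (β : (p : M) → TangentSpace (𝓡 n) p →L[ℝ] ℝ) (x y : E n) :
    bet (formCoef e β x) y = β (e.symm x) (coordVec e x y) := by
  rw [coordVec_eq_sum, map_sum]
  exact Finset.sum_congr rfl fun i _ ↦ by rw [map_smul, smul_eq_mul, mul_comm]; rfl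

theorem differentiableAt_formCoef [IsManifold (𝓡 n) ∞ M]
    {β : (p : M) → TangentSpace (𝓡 n) p →L[ℝ] ℝ}
    (hβ : ContMDiff (𝓡 n) ((𝓡 n).prod 𝓘(ℝ, GeneralAB.E n →L[ℝ] ℝ)) ∞
      (fun p ↦ Bundle.TotalSpace.mk' (GeneralAB.E n →L[ℝ] ℝ)
        (E := fun p : M ↦ TangentSpace (𝓡 n) p →L[ℝ] ℝ) p (β p)))
    {e : OpenPartialHomeomorph M (E n)}
    (he : e ∈ IsManifold.maximalAtlas (𝓡 n) ∞ M) {x : E n} (hx : x ∈ e.target) (i : Fin n) :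
    DifferentiableAt ℝ (fun x' ↦ formCoef e β x' i) x := by
  have hs : ContMDiffAt 𝓘(ℝ, E n) (𝓡 n) ∞ e.symm x := contMDiffAt_symm_of_mem_maximalAtlas he hx
  have h1 := hβ.contMDiffAt.comp x hs
  have h2 := ContMDiffAt.clm_bundle_apply (b := e.symm)
    (E₁ := fun p : M ↦ TangentSpace (𝓡 n) p) (E₂ := Bundle.Trivial M ℝ)
    (F₁ := E n) (F₂ := ℝ) (ϕ := fun x' ↦ β (e.symm x')) h1
    (contMDiffAt_coordVec he hx (EuclideanSpace.single i 1))
  rw [contMDiffAt_totalSpace] at h2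
  exact h2.2.contDiffAt.differentiableAt (by simp)

variable [RiemannianBundle (fun p : M ↦ TangentSpace (𝓡 n) p)]

theorem low_metricCoef (e : OpenPartialHomeomorph M (E n)) (x y : E n) (i : Fin n) :
    low (metricCoef e x) y i =
      inner ℝ (coordVec e x (EuclideanSpace.single i 1)) (coordVec e x y) := by
  rw [coordVec_eq_sum e x y, inner_sum]
  exact Finset.sum_congr rfl fun j _ ↦ by rw [inner_smul_right, mul_comm]; rfl

theorem sum_low_metricCoef (e : OpenPartialHomeomorph M (E n)) (x y z : E n) :
    ∑ i, low (metricCoef e x) y i * z i = inner ℝ (coordVec e x y) (coordVec e x z) := by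
  rw [coordVec_eq_sum e x z, inner_sum]
  exact Finset.sum_congr rfl fun j _ ↦ by
    rw [inner_smul_right, low_metricCoef, real_inner_comm, mul_comm]

theorem al_metricCoef (e : OpenPartialHomeomorph M (E n)) (x y : E n) :
    al (metricCoef e x) y = ‖coordVec e x y‖ := by
  rw [al, sum_low_metricCoef, real_inner_self_eq_norm_sq, Real.sqrt_sq (norm_nonneg _)]

theorem sv_metricCoef (e : OpenPartialHomeomorph M (E n))
    (β : (p : M) → TangentSpace (𝓡 n) p →L[ℝ] ℝ) (x y : E n) :
    sv (metricCoef e x) (formCoef e β x) y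
      = β (e.symm x) (coordVec e x y) / ‖coordVec e x y‖ := by
  rw [sv, bet_formCoef, al_metricCoef]

theorem metricCoef_symm (e : OpenPartialHomeomorph M (E n)) (x : E n) (i j : Fin n) :
    metricCoef e x i j = metricCoef e x j i :=
  real_inner_comm (coordVec e x (EuclideanSpace.single j 1))
    (coordVec e x (EuclideanSpace.single i 1))

theorem differentiableAt_metricCoef [IsManifold (𝓡 n) ∞ M]
    [IsContMDiffRiemannianBundle (𝓡 n) ∞ (E n) (fun p : M ↦ TangentSpace (𝓡 n) p)]
    {e : OpenPartialHomeomorph M (E n)}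
    (he : e ∈ IsManifold.maximalAtlas (𝓡 n) ∞ M) {x : E n} (hx : x ∈ e.target) (i j : Fin n) :
    DifferentiableAt ℝ (fun x' ↦ metricCoef e x' i j) x :=
  (ContMDiffAt.inner_bundle (contMDiffAt_coordVec he hx (EuclideanSpace.single i 1))
    (contMDiffAt_coordVec he hx (EuclideanSpace.single j 1))).contDiffAt.differentiableAt (by simp)

section

variable [IsManifold (𝓡 n) ∞ M] {e : OpenPartialHomeomorph M (E n)}
  (he : e ∈ IsManifold.maximalAtlas (𝓡 n) ∞ M) {x : E n} (hx : x ∈ e.target)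

include he hx

/-- A vector in the kernel of $a_{ij}$ would have length zero. -/
theorem isUnit_det_metricCoef : IsUnit (metricCoef e x).det := by
  rw [isUnit_iff_ne_zero]
  intro h0
  obtain ⟨w, hw0, hw⟩ := Matrix.exists_mulVec_eq_zero_iff.2 h0
  have hy : WithLp.toLp 2 w ≠ 0 := fun h ↦ hw0 (congrArg WithLp.ofLp h)
  have h1 := sum_low_metricCoef e x (WithLp.toLp 2 w) (WithLp.toLp 2 w)
  have h2 (i : Fin n) : low (metricCoef e x) (WithLp.toLp 2 w) i = 0 := congrFun hw i
  simp only [h2, zero_mul, Finset.sum_const_zero] at h1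
  exact coordVec_ne_zero he hx hy (inner_self_eq_zero.1 h1.symm)

/-- Here the intrinsic $b$, an operator norm, meets the coordinates: by Riesz $b^2=b_ib^i$, and
$|s|\le b$ is the operator norm bound. -/
theorem frame_metricCoef {b₀ : ℝ≥0∞} {β : (p : M) → TangentSpace (𝓡 n) p →L[ℝ] ℝ}
    (hb : ∀ p, ‖β p‖ₑ < b₀) :
    Frame b₀ (metricCoef e x) (formCoef e β x)
      (fun i ↦ ∑ j, (metricCoef e x)⁻¹ i j * formCoef e β x j) (‖β (e.symm x)‖ ^ 2) := by
  have hraise : ∀ i, ∑ j, metricCoef e x i j *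
      (∑ k, (metricCoef e x)⁻¹ j k * formCoef e β x k) = formCoef e β x i := by
    intro i
    have : (metricCoef e x).mulVec ((metricCoef e x)⁻¹.mulVec (formCoef e β x))
        = formCoef e β x := by
      rw [Matrix.mulVec_mulVec, Matrix.mul_nonsing_inv _ (isUnit_det_metricCoef he hx),
        Matrix.one_mulVec]
    exact congrFun this i
  refine ⟨metricCoef_symm e x, fun y hy ↦ ?_, hraise, ?_, fun y hy ↦ ⟨?_, ?_⟩⟩
  · rw [sum_low_metricCoef]
    exact real_inner_self_pos.2 (coordVec_ne_zero he hx hy)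
  · set bu : E n :=
      WithLp.toLp 2 fun i ↦ ∑ j, (metricCoef e x)⁻¹ i j * formCoef e β x j with hbu
    have hlow (i : Fin n) : low (metricCoef e x) bu i = formCoef e β x i := hraise i
    -- The vector $b^i\partial_i$ represents $\beta$ with respect to the inner product.
    have hβ : β (e.symm x) = innerSL ℝ (coordVec e x bu) := by
      ext v
      obtain ⟨z, rfl⟩ := (coordVec_bijective he hx).2 v
      rw [innerSL_apply_apply, ← sum_low_metricCoef, ← bet_formCoef]
      exact Finset.sum_congr rfl fun i _ ↦ by rw [hlow]
    have hn : ‖β (e.symm x)‖ = ‖coordVec e x bu‖ := by rw [hβ, innerSL_apply_norm]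
    rw [hn, ← real_inner_self_eq_norm_sq, ← sum_low_metricCoef]
    exact Finset.sum_congr rfl fun i _ ↦ by rw [hlow]
  · rw [sv_metricCoef]
    have hv : 0 < ‖coordVec e x y‖ := norm_pos_iff.2 (coordVec_ne_zero he hx hy)
    refine sq_le_sq' ?_ ?_
    · rw [le_div_iff₀ hv]
      have := neg_le_of_abs_le ((β (e.symm x)).le_opNorm (coordVec e x y))
      linarith
    · rw [div_le_iff₀ hv]
      exact le_of_abs_le ((β (e.symm x)).le_opNorm (coordVec e x y))
  · have h1 : √(‖β (e.symm x)‖ ^ 2) = ‖β (e.symm x)‖ := Real.sqrt_sq (norm_nonneg (β (e.symm x)))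
    have h2 : ENNReal.ofReal ‖β (e.symm x)‖ < b₀ :=
      (ofReal_norm (β (e.symm x))).trans_lt (hb _)
    change ENNReal.ofReal √(‖β (e.symm x)‖ ^ 2) < b₀
    rwa [h1]

end

end Charts

/-! ### Differentiability of the inverse matrix, by Cramer's rule -/

section Matrices

variable {m : ℕ} {A : E n → Matrix (Fin m) (Fin m) ℝ} {x : E n}

theorem differentiableAt_det (hA : ∀ i j, DifferentiableAt ℝ (fun x' ↦ A x' i j) x) :
    DifferentiableAt ℝ (fun x' ↦ (A x').det) x := by
  simp only [Matrix.det_apply']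
  exact DifferentiableAt.fun_sum fun σ _ ↦
    (differentiableAt_const _).mul
      (HasFDerivAt.finsetProd fun i _ ↦ (hA (σ i) i).hasFDerivAt).differentiableAt

theorem differentiableAt_adjugate (hA : ∀ i j, DifferentiableAt ℝ (fun x' ↦ A x' i j) x)
    (i j : Fin m) : DifferentiableAt ℝ (fun x' ↦ (A x').adjugate i j) x := by
  simp only [Matrix.adjugate_apply]
  refine differentiableAt_det fun k l ↦ ?_
  simp only [Matrix.updateRow_apply]
  split_ifs
  · exact differentiableAt_const _
  · exact hA k l

theorem differentiableAt_inv_matrix (hA : ∀ i j, DifferentiableAt ℝ (fun x' ↦ A x' i j) x)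
    (h0 : (A x).det ≠ 0) (i j : Fin m) : DifferentiableAt ℝ (fun x' ↦ (A x')⁻¹ i j) x := by
  simp only [Matrix.inv_def, Ring.inverse_eq_inv', Matrix.smul_apply, smul_eq_mul]
  exact ((differentiableAt_det hA).inv h0).mul (differentiableAt_adjugate hA i j)

end Matrices

/-! ### Assembly on the manifold -/

section Final

variable {M : Type*} [TopologicalSpace M] [ChartedSpace (E n) M] [IsManifold (𝓡 n) ∞ M]
  [RiemannianBundle (fun p : M ↦ TangentSpace (𝓡 n) p)]
  [IsContMDiffRiemannianBundle (𝓡 n) ∞ (E n) (fun p : M ↦ TangentSpace (𝓡 n) p)]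
  {β : (p : M) → TangentSpace (𝓡 n) p →L[ℝ] ℝ}

theorem conformalAt_of_covDerivEq
    (hβ : ContMDiff (𝓡 n) ((𝓡 n).prod 𝓘(ℝ, E n →L[ℝ] ℝ)) ∞
      (fun p ↦ TotalSpace.mk' (E n →L[ℝ] ℝ)
        (E := fun p : M ↦ TangentSpace (𝓡 n) p →L[ℝ] ℝ) p (β p)))
    {b₀ : ℝ≥0∞} (hb : ∀ p, ‖β p‖ₑ < b₀) {c : M → ℝ} (hc : CovDerivEq β c)
    {e : OpenPartialHomeomorph M (E n)} (he : e ∈ IsManifold.maximalAtlas (𝓡 n) ∞ M) {x : E n}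
    (hx : x ∈ e.target) :
    ConformalAt b₀ (metricCoef e) (formCoef e β)
      (fun x i ↦ ∑ j, (metricCoef e x)⁻¹ i j * formCoef e β x j)
      (fun x ↦ ‖β (e.symm x)‖ ^ 2) (christoffel e x) (c (e.symm x)) x where
  frame := by
    filter_upwards [e.open_target.mem_nhds hx] with x' hx' using frame_metricCoef he hx' hb
  diffA i j := differentiableAt_metricCoef he hx i j
  diffB i := differentiableAt_formCoef hβ he hx i
  diffbu i := DifferentiableAt.fun_sum fun j _ ↦
    (differentiableAt_inv_matrix (differentiableAt_metricCoef he hx)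
      (isUnit_det_metricCoef he hx).ne_zero i j).mul (differentiableAt_formCoef hβ he hx j)
  christoffel_symm k i j := by
    simp only [christoffel]
    congr 1
    refine Finset.sum_congr rfl fun l _ ↦ ?_
    rw [show (fun x' ↦ metricCoef e x' i j) = fun x' ↦ metricCoef e x' j i from
      funext fun x' ↦ metricCoef_symm e x' i j]
    ring
  -- Lowering the upper index cancels the inverse metric in the Christoffel symbol.
  levi_civita l i j := by
    have h := congrFun (Matrix.mulVec_mulVec (fun m ↦ pd i (fun x' ↦ metricCoef e x' m j) x
      + pd j (fun x' ↦ metricCoef e x' m i) x - pd m (fun x' ↦ metricCoef e x' i j) x)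
      (metricCoef e x) (metricCoef e x)⁻¹) l
    rw [Matrix.mul_nonsing_inv _ (isUnit_det_metricCoef he hx), Matrix.one_mulVec] at h
    rw [← h, Matrix.mulVec, dotProduct, Finset.mul_sum]
    exact Finset.sum_congr rfl fun k _ ↦ by
      rw [christoffel, Matrix.mulVec, dotProduct]; ring
  covDeriv i j := by
    have := hc e he x hx i j
    rw [GeneralAB.covDeriv] at this
    linarith

/-- The Douglas tensor in local coordinates. -/
theorem douglas_metric_eq
    (hβ : ContMDiff (𝓡 n) ((𝓡 n).prod 𝓘(ℝ, E n →L[ℝ] ℝ)) ∞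
      (fun p ↦ TotalSpace.mk' (E n →L[ℝ] ℝ)
        (E := fun p : M ↦ TangentSpace (𝓡 n) p →L[ℝ] ℝ) p (β p)))
    {b₀ : ℝ≥0∞} (hb₀ : 0 < b₀) (hb : ∀ p, ‖β p‖ₑ < b₀) {φ : ℝ × ℝ → ℝ}
    (hφ : ContDiffOn ℝ ∞ φ (dom b₀)) (hφpos : ∀ q ∈ dom b₀, 0 < φ q)
    (hF : IsFinslerMetric (metric φ β : (p : M) → TangentSpace (𝓡 n) p → ℝ))
    {c : M → ℝ} (hc : CovDerivEq β c)
    {e : OpenPartialHomeomorph M (E n)} (he : e ∈ IsManifold.maximalAtlas (𝓡 n) ∞ M) {x : E n}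
    (hx : x ∈ e.target) {y : E n} (hy : y ≠ 0) (i j k l : Fin n) :
    let q : ℝ × ℝ :=
      (‖β (e.symm x)‖ ^ 2, β (e.symm x) (coordVec e x y) / ‖coordVec e x y‖)
    douglas (inCoord e (metric φ β)) i j k l x y =
      douglasFormula (c (e.symm x)) ‖coordVec e x y‖ q.2 (metricCoef e x) (formCoef e β x)
        (fun i ↦ ∑ j, (metricCoef e x)⁻¹ i j * formCoef e β x j)
        (fun i ↦ ∑ j, metricCoef e x i j * y j) (fun i ↦ y i)
        (fun i j ↦ if i = j then 1 else 0) (funT n b₀ φ q) (d2 b₀ (funT n b₀ φ) q)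
        (d2 b₀ (d2 b₀ (funT n b₀ φ)) q) (d2 b₀ (d2 b₀ (d2 b₀ (funT n b₀ φ))) q)
        (d2 b₀ (funH b₀ φ) q) (d2 b₀ (d2 b₀ (funH b₀ φ)) q)
        (d2 b₀ (d2 b₀ (d2 b₀ (funH b₀ φ))) q) i j k l := by
  intro q
  have h := (conformalAt_of_covDerivEq hβ hb hc he hx).douglas_eq (φ := φ)
    (L := inCoord e (metric φ β)) hb₀ hφ hφpos
    (.of_forall fun x' y' ↦ by rw [al_metricCoef, sv_metricCoef]; rfl)
    (fun x' y' r hr ↦ by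
      rw [inCoord, ← coordLin_apply, map_smul]
      exact hF.homogeneous _ _ r hr)
    (fun y' hy' ↦ hF.posDef e he x hx y' hy') hy i j k l
  rw [al_metricCoef, sv_metricCoef] at h
  exact h

end Final

end GeneralAB

end

theorem proposition3p1 {n : ℕ} {M : Type*} [TopologicalSpace M]
    [ChartedSpace (GeneralAB.E n) M] [IsManifold (𝓡 n) ∞ M]
    [Bundle.RiemannianBundle (fun p : M ↦ TangentSpace (𝓡 n) p)]
    [IsContMDiffRiemannianBundle (𝓡 n) ∞ (GeneralAB.E n) (fun p : M ↦ TangentSpace (𝓡 n) p)]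
    (β : (p : M) → TangentSpace (𝓡 n) p →L[ℝ] ℝ)
    (hβ : ContMDiff (𝓡 n) ((𝓡 n).prod 𝓘(ℝ, GeneralAB.E n →L[ℝ] ℝ)) ∞
      (fun p ↦ Bundle.TotalSpace.mk' (GeneralAB.E n →L[ℝ] ℝ)
        (E := fun p : M ↦ TangentSpace (𝓡 n) p →L[ℝ] ℝ) p (β p)))
    (b₀ : ℝ≥0∞) (hb₀ : 0 < b₀) (hb : ∀ p, ‖β p‖ₑ < b₀)
    (φ : ℝ × ℝ → ℝ) (hφ : ContDiffOn ℝ ∞ φ (GeneralAB.dom b₀))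
    (hφpos : ∀ q ∈ GeneralAB.dom b₀, 0 < φ q)
    (hF : GeneralAB.IsFinslerMetric (GeneralAB.metric φ β : (p : M) → TangentSpace (𝓡 n) p → ℝ))
    (c : M → ℝ) (hc : GeneralAB.CovDerivEq β c) :
    (∀ e ∈ IsManifold.maximalAtlas (𝓡 n) ∞ M, ∀ x ∈ e.target, ∀ y : GeneralAB.E n, y ≠ 0 →
      ∀ i j k l : Fin n,
      let p : M := e.symm x
      let v : TangentSpace (𝓡 n) p := GeneralAB.coordVec e x y
      let C : ℝ := c p
      let α : ℝ := ‖v‖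
      let s : ℝ := β p v / α
      let q : ℝ × ℝ := (‖β p‖ ^ 2, s)
      let a : Matrix (Fin n) (Fin n) ℝ := GeneralAB.metricCoef e x
      let b : Fin n → ℝ := GeneralAB.formCoef e β x
      let bu : Fin n → ℝ := fun i ↦ ∑ j, a⁻¹ i j * b j
      let yl : Fin n → ℝ := fun i ↦ ∑ j, a i j * y j
      let δ : Fin n → Fin n → ℝ := fun i j ↦ if i = j then 1 else 0
      let T : ℝ := GeneralAB.funT n b₀ φ q
      let T2 : ℝ := GeneralAB.d2 b₀ (GeneralAB.funT n b₀ φ) q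
      let T22 : ℝ := GeneralAB.d2 b₀ (GeneralAB.d2 b₀ (GeneralAB.funT n b₀ φ)) q
      let T222 : ℝ :=
        GeneralAB.d2 b₀ (GeneralAB.d2 b₀ (GeneralAB.d2 b₀ (GeneralAB.funT n b₀ φ))) q
      let H2 : ℝ := GeneralAB.d2 b₀ (GeneralAB.funH b₀ φ) q
      let H22 : ℝ := GeneralAB.d2 b₀ (GeneralAB.d2 b₀ (GeneralAB.funH b₀ φ)) q
      let H222 : ℝ :=
        GeneralAB.d2 b₀ (GeneralAB.d2 b₀ (GeneralAB.d2 b₀ (GeneralAB.funH b₀ φ))) q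
      GeneralAB.douglas (GeneralAB.inCoord e (GeneralAB.metric φ β)) i j k l x y =
        C / α * GeneralAB.cyc (fun j k l ↦
            ((T - s * T2) * a k l + T22 * b l * b k) * δ i j
            + 1 / α ^ 2 * (s / α * (3 * T22 + s * T222) * yl l * yl j
                - (T22 + s * T222) * b l * yl j) * b k * y i) j k l
        - C / α ^ 2 * GeneralAB.cyc (fun j k l ↦
            s * T22 * ((yl k * b l + yl l * b k) * δ i j + a j l * b k * y i)
            + 1 / α * (T - s * T2 - s ^ 2 * T22) * (yl l * δ i j + a l j * y i) * yl k) j k l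
        + C / α ^ 2 * (1 / α ^ 3 * (3 * T - 3 * s * T2 - 6 * s ^ 2 * T22 - s ^ 3 * T222)
              * yl k * yl j * yl l
            + T222 * b l * b k * b j) * y i
        + C / α * GeneralAB.cyc (fun j k l ↦
            ((H2 - s * H22) * (b j - s / α * yl j) * a k l
              - 1 / α ^ 2 * (H2 - s * H22 - s ^ 2 * H222) * b l * yl j * yl k
              - s * H222 / α * b k * b l * yl j) * bu i) j k l
        + C / α * (s / α ^ 3 * (3 * H2 - 3 * s * H22 - s ^ 2 * H222) * yl j * yl k * yl l
            + H222 * b l * b k * b j) * bu i)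
    ∧ ((∀ p, c p = 0) →
        GeneralAB.IsDouglasMetric
          (GeneralAB.metric φ β : (p : M) → TangentSpace (𝓡 n) p → ℝ)) := by
  have key := fun e he x hx y hy ↦ GeneralAB.douglas_metric_eq (e := e) (x := x) (y := y)
    hβ hb₀ hb hφ hφpos hF hc he hx hy
  refine ⟨fun e he x hx y hy i j k l ↦ key e he x hx y hy i j k l,
    fun h0 e he x hx y hy i j k l ↦ (key e he x hx y hy i j k l).trans ?_⟩
  -- Every term of the formula carries the factor $c$.
  simp [GeneralAB.douglasFormula, h0]
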